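/- Call a graph $3$-polytopal if it is finite, planar and $3$-connected, where a graph is $k$-connected if it has more than $k$ vertices and remains connected after the removal of any fewer than $k$ vertices. A graph is outerplanar if it can be drawn in the plane without crossings with all its vertices on the boundary of the unbounded face. Let $A$ and $B$ be finite simple graphs, each with at least two vertices. Then (every graph isomorphic to) the Cartesian product $A \mathbin{\square} B$ is $3$-polytopal if and only if, up to interchanging $A$ and $B$, at least one of the following holds: 1. $A\cong K_2$, and $B$ is outerplanar and $2$-connected; 2. $A\cong P_n$, the path on $n$ vertices, for some $n\ge 2$, and $B\cong C_k$, the $k$-gon (cycle on $k$ vertices), for some $k\ge 3$. -/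

import Mathlib

namespace SimpleGraph

/-- `G` is `k`-connected: it has more than `k` vertices, and it stays connected whenever fewer than
`k` vertices are removed. -/
def IsKConnected {V : Type*} (G : SimpleGraph V) (k : ℕ) : Prop :=
  (k : ℕ∞) < ENat.card V ∧ ∀ S : Set V, S.encard < k → (G.induce Sᶜ).Connected

/-- A drawing of `G` in the Euclidean plane (taken to be `ℂ`) without crossings: distinct vertices
are distinct points, every edge is a simple arc joining its two ends, an edge passes through
no vertex other than its ends, and two different edges meet only at common ends. -/
structure PlaneDrawing {V : Type*} (G : SimpleGraph V) where
  /-- the point of the plane that represents a vertex -/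
  point : V → ℂ
  /-- the set of points of the plane that represents an edge, ends included -/
  arc : G.edgeSet → Set ℂ
  point_injective : Function.Injective point
  isArc : ∀ (v w : V) (h : G.Adj v w), ∃ γ : _root_.Path (point v) (point w),
    Function.Injective γ ∧ Set.range γ = arc ⟨s(v, w), h⟩
  mem_of_point_mem_arc : ∀ (e : G.edgeSet) (v : V), point v ∈ arc e → v ∈ (e : Sym2 V)
  arc_inter_arc : ∀ e f : G.edgeSet, e ≠ f → ∀ z : ℂ, z ∈ arc e → z ∈ arc f →
    ∃ v : V, v ∈ (e : Sym2 V) ∧ v ∈ (f : Sym2 V) ∧ z = point v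

/-- The set of all points of the plane that are covered by a drawing. -/
def PlaneDrawing.carrier {V : Type*} {G : SimpleGraph V} (D : G.PlaneDrawing) : Set ℂ :=
  Set.range D.point ∪ ⋃ e, D.arc e

/-- The faces (regions) of a drawing are the connected components of the complement of the
drawing. -/
def PlaneDrawing.IsFace {V : Type*} {G : SimpleGraph V} (D : G.PlaneDrawing) (F : Set ℂ) : Prop :=
  ∃ z ∈ D.carrierᶜ, F = connectedComponentIn D.carrierᶜ z

/-- A graph is planar if it can be drawn in the plane without crossings. -/
def IsPlanar {V : Type*} (G : SimpleGraph V) : Prop :=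
  Nonempty G.PlaneDrawing

/-- A graph is outerplanar if it can be drawn in the plane without crossings so that all the
vertices lie on the boundary of the unbounded (external) face. -/
def IsOuterplanar {V : Type*} (G : SimpleGraph V) : Prop :=
  ∃ D : G.PlaneDrawing, ∃ F : Set ℂ, D.IsFace F ∧ ¬ Bornology.IsBounded F ∧
    ∀ v : V, D.point v ∈ frontier F

/-- A graph is `3`-polytopal if it is finite, planar and `3`-connected. -/
def IsThreePolytopal {V : Type*} (G : SimpleGraph V) : Prop :=
  Finite V ∧ G.IsPlanar ∧ G.IsKConnected 3

end SimpleGraph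

/-! Nonplanarity rests on winding numbers instead of Euler's formula or the Jordan curve theorem.
For vertex-disjoint edges with paths `γ`, `δ`, the difference `γ s - δ t` never vanishes, so it has
a continuous logarithm, whose total change around the parameter square is zero. This gives one
integer equation per pair of disjoint edges (`WeakDrawing.exists_winding`), and for K₅ and K₃,₃ the
resulting system is unsolvable modulo 2. Only disjoint edges are compared, so the obstruction
applies to weak drawings, where edges with a common end may meet; these pass to minors at once
(`IsMinorModel.nonempty_weakDrawing`).

Let A □ B be 3-polytopal; both factors are then connected. If A ≅ K₂, one copy of B lies in a single
face of the other copy, and the rungs put every vertex of that other copy on the boundary of this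
face; an inversion makes the face unbounded, so B is outerplanar
(`IsPlanar.isOuterplanar_of_boxProd`). Deleting both copies of a vertex shows that B is 2-connected.
If both factors have at least three vertices, each contains a path on three vertices. A claw times
such a path has a K₃,₃ minor, so both factors have maximum degree at most two and are paths or
cycles. Two paths give a vertex of degree two, and two cycles contract to K₃ □ K₃, which has a K₃,₃
minor. One path and one cycle remain.

Conversely, a nontrivial connected graph times a 2-connected graph is 3-connected
(`IsKConnected.boxProd`), and the products are drawn explicitly. For a path and a cycle, concentric
circles and radii serve. For K₂ □ B, a cone over an outerplanar graph still has a weak drawing, so B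
has no K₄ and no K₂,₃ minor. Ears then extend any cycle until it is Hamiltonian, since a stuck ear
is a K₂,₃ minor, and two crossing chords would be a K₄ minor (`IsOuterplanar.exists_equiv`). With
the vertices on a line in this order, the edges become disjoint arches, and two mirrored copies are
joined by vertical rungs. -/

/-! ### Continuous logarithms -/

/-- A continuous nowhere vanishing function on a real topological vector space has a continuous
logarithm. -/
theorem Complex.exists_continuousMap_exp_eq {E : Type*} [NormedAddCommGroup E] [NormedSpace ℝ E]
    (f : C(E, ℂ)) (hf : ∀ x, f x ≠ 0) : ∃ L : C(E, ℂ), ∀ x, Complex.exp (L x) = f x := by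
  obtain ⟨L, ⟨-, hL⟩, -⟩ := Complex.isCoveringMapOn_exp.existsUnique_continuousMap_lifts f
    (a₀ := 0) (Complex.exp_log (hf 0)) hf
  exact ⟨L, fun x => congrFun hL x⟩

/-- All continuous logarithms of a function have the same change between two points, which is
determined up to an integer multiple of `2πi` by the values of the function at these points. -/
theorem Complex.exists_int_log_change {E : Type*} [NormedAddCommGroup E] [NormedSpace ℝ E]
    (f : C(E, ℂ)) (a b : E) {l m : ℂ} (hl : Complex.exp l = f a) (hm : Complex.exp m = f b) :
    ∃ n : ℤ, ∀ L : C(E, ℂ), (∀ x, Complex.exp (L x) = f x) →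
      L b - L a = m - l + n * (2 * Real.pi * Complex.I) := by
  by_cases h : ∃ L : C(E, ℂ), ∀ x, Complex.exp (L x) = f x
  · obtain ⟨L, hL⟩ := h
    have hf : ∀ x, f x ≠ 0 := fun x => hL x ▸ Complex.exp_ne_zero _
    obtain ⟨p, hp⟩ := Complex.exp_eq_exp_iff_exists_int.1 ((hL a).trans hl.symm)
    obtain ⟨q, hq⟩ := Complex.exp_eq_exp_iff_exists_int.1 ((hL b).trans hm.symm)
    refine ⟨q - p, fun L' hL' => ?_⟩
    have huniq := (Complex.isCoveringMapOn_exp.existsUnique_continuousMap_lifts f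
      (hL a) hf).unique (y₁ := L) (y₂ := ⟨fun x => L' x + (L a - L' a), by fun_prop⟩)
      ⟨rfl, funext hL⟩ ⟨by simp, funext fun x => ?_⟩
    · have h1 : L b = L' b + (L a - L' a) := congrArg (fun g : C(E, ℂ) => g b) huniq
      push_cast
      linear_combination hq - hp - h1
    · change Complex.exp (L' x + (L a - L' a)) = f x
      rw [Complex.exp_add, Complex.exp_sub, hL, hL', hL', div_self (hf a), mul_one]
  · exact ⟨0, fun L hL => (h ⟨L, hL⟩).elim⟩

/-! ### The winding obstruction: K₅ and K₃,₃ are not planar -/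

namespace SimpleGraph

/-- A drawing of `G` in the plane by continuous paths in which two edges may meet arbitrarily as
long as they have a common end. -/
structure WeakDrawing {V : Type*} (G : SimpleGraph V) where
  /-- the point of the plane that represents a vertex -/
  point : V → ℂ
  /-- the path that represents an edge -/
  path : ∀ {u v : V}, G.Adj u v → _root_.Path (point u) (point v)
  point_injective : Function.Injective point
  point_notMem : ∀ {u v w : V} (h : G.Adj u v), w ≠ u → w ≠ v → point w ∉ Set.range (path h)
  disjoint : ∀ {u v w x : V} (h : G.Adj u v) (h' : G.Adj w x), u ≠ w → u ≠ x → v ≠ w → v ≠ x →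
    Disjoint (Set.range (path h)) (Set.range (path h'))

namespace WeakDrawing

variable {V : Type*} {G : SimpleGraph V}

/-- The change of the logarithm of `γ s - δ t` around the boundary of the square is zero. -/
theorem exists_winding [LinearOrder V] (D : G.WeakDrawing) :
    ∃ n : V → V → V → ℤ, ∀ u v w x : V, G.Adj u v → G.Adj w x → u < v → w < x →
      u ≠ w → u ≠ x → v ≠ w → v ≠ x →
      (if w < v then 0 else 1) - (if w < u then 0 else 1) + (if v < x then 0 else 1) -
        (if u < x then 0 else 1) + n w u v + n v w x - n u w x - n x u v = (0 : ℤ) := by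
  classical
  obtain ⟨p, γ, hinj, -, hdisj⟩ := D
  -- `ℓ u v` is a logarithm of `p v - p u`: the principal one in the increasing direction, with `πi`
  -- added in the decreasing one. Opposite directions thus differ by an explicit half turn, which
  -- produces the `if` terms.
  let ℓ₀ : V → V → ℂ := fun u v => Complex.log (p (max u v) - p (min u v))
  let ℓ : V → V → ℂ := fun u v =>
    ℓ₀ u v + (if u < v then (0 : ℤ) else 1 : ℤ) * (Real.pi * Complex.I)
  have hsymm : ∀ u v, ℓ₀ u v = ℓ₀ v u := fun u v => by simp [ℓ₀, max_comm, min_comm]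
  have hℓ : ∀ u v, u ≠ v → Complex.exp (ℓ u v) = p v - p u := by
    intro u v huv
    rcases huv.lt_or_gt with h | h
    · simp only [ℓ, ℓ₀, h, if_true, max_eq_right h.le, min_eq_left h.le]
      simp [Complex.exp_log (sub_ne_zero.2 (hinj.ne huv.symm))]
    · simp only [ℓ, ℓ₀, h.not_gt, if_false, max_eq_left h.le, min_eq_right h.le]
      simp [Complex.exp_add, Complex.exp_log (sub_ne_zero.2 (hinj.ne huv))]
  -- Both signs of the difference are allowed, because opposite sides of the square see it with
  -- opposite signs. Adding `πi` to a logarithm does not affect its change, so one `n` serves both.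
  have key : ∀ u w x (h : G.Adj w x), u ≠ w → u ≠ x → ∃ n : ℤ, ∀ L : C(ℝ, ℂ),
      ((∀ t, Complex.exp (L t) = (γ h).extend t - p u) ∨
        (∀ t, Complex.exp (L t) = p u - (γ h).extend t)) →
      L 1 - L 0 = ℓ u x - ℓ u w + n * (2 * Real.pi * Complex.I) := by
    intro u w x h huw hux
    obtain ⟨n, hn⟩ := Complex.exists_int_log_change
      (⟨fun t => (γ h).extend t - p u, by fun_prop⟩ : C(ℝ, ℂ)) 0 1 (l := ℓ u w) (m := ℓ u x)
      (by simp [hℓ u w huw]) (by simp [hℓ u x hux])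
    refine ⟨n, fun L hL => ?_⟩
    rcases hL with hL | hL
    · exact hn L hL
    · have := hn ⟨fun t => L t + Real.pi * Complex.I, by fun_prop⟩ fun t => by
        simp [Complex.exp_add, hL]
      simpa using this
  choose! n hn using fun u w x h (h1 : u ≠ w) (h2 : u ≠ x) => key u w x h h1 h2
  refine ⟨n, ?_⟩
  intro u v w x huv hwx luv lwx huw hux hvw hvx
  have hne : ∀ s t : ℝ, (γ huv).extend s - (γ hwx).extend t ≠ 0 := by
    intro s t h0
    refine Set.disjoint_left.1 (hdisj huv hwx huw hux hvw hvx)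
      ((γ huv).extend_range.subset ⟨s, rfl⟩) ?_
    rw [sub_eq_zero.1 h0]
    exact (γ hwx).extend_range.subset ⟨t, rfl⟩
  -- Paths extended constantly make the difference nonzero on all of `ℝ × ℝ`. The four sides of the
  -- unit square are restrictions of one logarithm, and their changes cancel.
  obtain ⟨L, hL⟩ := Complex.exists_continuousMap_exp_eq
    (⟨fun z : ℝ × ℝ => (γ huv).extend z.1 - (γ hwx).extend z.2, by fun_prop⟩ : C(ℝ × ℝ, ℂ))
    fun z => hne z.1 z.2
  have e1 := hn w u v huv huw.symm hvw.symm ⟨fun s => L (s, 0), by fun_prop⟩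
    (Or.inl fun t => by simp [hL])
  have e2 := hn x u v huv hux.symm hvx.symm ⟨fun s => L (s, 1), by fun_prop⟩
    (Or.inl fun t => by simp [hL])
  have e3 := hn u w x hwx huw hux ⟨fun s => L (0, s), by fun_prop⟩
    (Or.inr fun t => by simp [hL])
  have e4 := hn v w x hwx hvw hvx ⟨fun s => L (1, s), by fun_prop⟩
    (Or.inr fun t => by simp [hL])
  simp only [ContinuousMap.coe_mk] at e1 e2 e3 e4
  have hpi : (2 * Real.pi * Complex.I : ℂ) ≠ 0 := Complex.two_pi_I_ne_zero
  have flip : ∀ a b : V, a ≠ b → (if a < b then (0 : ℤ) else 1) = 1 - if b < a then 0 else 1 := by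
    intro a b hab
    rcases hab.lt_or_gt with h | h <;> simp [h, h.not_gt]
  have e : (((if w < v then 0 else 1) - (if w < u then 0 else 1) + (if v < x then 0 else 1) -
        (if u < x then 0 else 1) + n w u v + n v w x - n u w x - n x u v : ℤ) : ℂ)
        * (2 * Real.pi * Complex.I) = 0 := by
    simp only [ℓ] at e1 e2 e3 e4
    rw [hsymm x v, hsymm x u, flip x v hvx.symm, flip x u hux.symm] at e2
    rw [hsymm u w, flip u w huw] at e3
    rw [hsymm v w, flip v w hvw] at e4
    push_cast at e1 e2 e3 e4 ⊢
    linear_combination e2 + e3 - e1 - e4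
  exact_mod_cast (mul_eq_zero.1 e).resolve_right hpi

/-- The complete graph on five vertices is not planar. -/
theorem isEmpty_top_five : IsEmpty (⊤ : SimpleGraph (Fin 5)).WeakDrawing := by
  refine ⟨fun D => ?_⟩
  obtain ⟨n, hn⟩ := D.exists_winding
  have H : ∀ u v w x : Fin 5, u < v ∧ w < x ∧ u ≠ w ∧ u ≠ x ∧ v ≠ w ∧ v ≠ x → _ :=
    fun u v w x h => hn u v w x h.1.ne h.2.1.ne h.1 h.2.1 h.2.2.1 h.2.2.2.1 h.2.2.2.2.1 h.2.2.2.2.2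
  have h0 := H 0 1 2 3 (by decide)
  have h1 := H 0 1 2 4 (by decide)
  have h2 := H 0 1 3 4 (by decide)
  have h3 := H 0 2 1 3 (by decide)
  have h4 := H 0 2 1 4 (by decide)
  have h5 := H 0 2 3 4 (by decide)
  have h6 := H 0 3 1 2 (by decide)
  have h7 := H 0 3 1 4 (by decide)
  have h8 := H 0 3 2 4 (by decide)
  have h9 := H 0 4 1 2 (by decide)
  have h10 := H 0 4 1 3 (by decide)
  have h11 := H 0 4 2 3 (by decide)
  have h12 := H 1 2 3 4 (by decide)
  have h13 := H 1 3 2 4 (by decide)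
  have h14 := H 1 4 2 3 (by decide)
  -- The constant term of an equation is odd exactly when the ends of the two edges interlace. Over
  -- all fifteen pairs each unknown occurs twice, while five pairs interlace, one for each set of
  -- four vertices: a contradiction modulo 2.
  simp at h0 h1 h2 h3 h4 h5 h6 h7 h8 h9 h10 h11 h12 h13 h14
  omega

/-- The complete bipartite graph `K₃,₃` is not planar. -/
theorem isEmpty_of_adj_iff_even_add (G : SimpleGraph (Fin 6))
    (hG : ∀ u v : Fin 6, G.Adj u v ↔ ¬ Even (u.val + v.val)) : IsEmpty G.WeakDrawing := by
  refine ⟨fun D => ?_⟩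
  obtain ⟨n, hn⟩ := D.exists_winding
  have H : ∀ u v w x : Fin 6, ¬ Even (u.val + v.val) ∧ ¬ Even (w.val + x.val) ∧ u < v ∧ w < x ∧
      u ≠ w ∧ u ≠ x ∧ v ≠ w ∧ v ≠ x → _ :=
    fun u v w x h => hn u v w x ((hG u v).2 h.1) ((hG w x).2 h.2.1) h.2.2.1 h.2.2.2.1
      h.2.2.2.2.1 h.2.2.2.2.2.1 h.2.2.2.2.2.2.1 h.2.2.2.2.2.2.2
  have h0 := H 0 1 2 3 (by decide)
  have h1 := H 0 1 2 5 (by decide)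
  have h2 := H 0 1 3 4 (by decide)
  have h3 := H 0 1 4 5 (by decide)
  have h4 := H 0 3 1 2 (by decide)
  have h5 := H 0 3 1 4 (by decide)
  have h6 := H 0 3 2 5 (by decide)
  have h7 := H 0 3 4 5 (by decide)
  have h8 := H 0 5 1 2 (by decide)
  have h9 := H 0 5 1 4 (by decide)
  have h10 := H 0 5 2 3 (by decide)
  have h11 := H 0 5 3 4 (by decide)
  have h12 := H 1 2 3 4 (by decide)
  have h13 := H 1 2 4 5 (by decide)
  have h14 := H 1 4 2 3 (by decide)
  have h15 := H 1 4 2 5 (by decide)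
  have h16 := H 2 3 4 5 (by decide)
  have h17 := H 2 5 3 4 (by decide)
  -- Again each unknown occurs twice in all. On the hexagon `0, …, 5` the interlacing pairs are
  -- those of the three long diagonals, an odd number.
  simp at h0 h1 h2 h3 h4 h5 h6 h7 h8 h9 h10 h11 h12 h13 h14 h15 h16 h17
  omega

end WeakDrawing

end SimpleGraph

/-! ### Minors, cones and the forbidden minors of outerplanar graphs -/

namespace SimpleGraph

variable {V W : Type*} {G : SimpleGraph V} {H : SimpleGraph W}

theorem PlaneDrawing.nonempty_weakDrawing (D : G.PlaneDrawing) : Nonempty G.WeakDrawing := by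
  choose γ hγ hr using D.isArc
  refine ⟨⟨D.point, fun {u v} h => γ u v h, D.point_injective, ?_, ?_⟩⟩
  · intro u v w h hu hv hw
    rw [hr] at hw
    simpa [hu, hv] using D.mem_of_point_mem_arc _ _ hw
  · intro u v w x h h' huw hux hvw hvx
    rw [hr, hr, Set.disjoint_left]
    intro z hz hz'
    obtain ⟨y, hy, hy', -⟩ := D.arc_inter_arc ⟨s(u, v), h⟩ ⟨s(w, x), h'⟩
      (by simp [Subtype.ext_iff, huw, hux]) z hz hz'
    simp only [Sym2.mem_iff] at hy hy'
    rcases hy with rfl | rfl <;> rcases hy' with rfl | rfl <;> contradiction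

/-- A weak drawing of `G` restricts to any graph that maps injectively to `G`. -/
def WeakDrawing.comap (D : G.WeakDrawing) (f : H →g G) (hf : Function.Injective f) :
    H.WeakDrawing where
  point w := D.point (f w)
  path h := D.path (f.map_adj h)
  point_injective := D.point_injective.comp hf
  point_notMem h hu hv := D.point_notMem (f.map_adj h) (hf.ne hu) (hf.ne hv)
  disjoint h h' h1 h2 h3 h4 := D.disjoint (f.map_adj h) (f.map_adj h')
    (hf.ne h1) (hf.ne h2) (hf.ne h3) (hf.ne h4)

/-- The part of the plane covered by the drawing of the subgraph induced by `S`. -/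
def WeakDrawing.carrier (D : G.WeakDrawing) (S : Set V) : Set ℂ :=
  {z | (∃ u ∈ S, z = D.point u) ∨
    ∃ u ∈ S, ∃ v ∈ S, ∃ h : G.Adj u v, z ∈ Set.range (D.path h)}

theorem WeakDrawing.disjoint_carrier (D : G.WeakDrawing) {S T : Set V} (hST : Disjoint S T) :
    Disjoint (D.carrier S) (D.carrier T) := by
  have hne : ∀ {a b}, a ∈ S → b ∈ T → a ≠ b := fun ha hb h =>
    Set.disjoint_left.1 hST ha (h ▸ hb)
  rw [Set.disjoint_left]
  rintro z (⟨u, hu, rfl⟩ | ⟨u, hu, v, hv, h, hz⟩) (⟨w, hw, hz'⟩ | ⟨w, hw, x, hx, h', hz'⟩)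
  · exact hne hu hw (D.point_injective hz')
  · exact D.point_notMem h' (hne hu hw) (hne hu hx) hz'
  · subst hz'
    exact D.point_notMem h (hne hu hw).symm (hne hv hw).symm hz
  · exact Set.disjoint_left.1 (D.disjoint h h' (hne hu hw) (hne hu hx) (hne hv hw) (hne hv hx))
      hz hz'

theorem WeakDrawing.exists_path (D : G.WeakDrawing) {S : Set V} {a b : S}
    (h : (G.induce S).Reachable a b) :
    ∃ γ : _root_.Path (D.point a) (D.point b), Set.range γ ⊆ D.carrier S := by
  obtain ⟨q⟩ := h
  induction q with
  | nil =>
    refine ⟨.refl _, ?_⟩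
    rintro _ ⟨t, rfl⟩
    exact Or.inl ⟨_, Subtype.prop _, rfl⟩
  | @cons u v w h q ih =>
    obtain ⟨γ, hγ⟩ := ih
    refine ⟨(D.path (show G.Adj u v from h)).trans γ, ?_⟩
    rw [_root_.Path.trans_range]
    exact Set.union_subset (fun z hz => Or.inr ⟨u, u.2, v, v.2, h, hz⟩) hγ

/-- The sets `M w` are the branch sets of a minor of `G` isomorphic to `H`. -/
structure IsMinorModel (H : SimpleGraph W) (G : SimpleGraph V) (M : W → Set V) : Prop where
  connected : ∀ w, (G.induce (M w)).Connected
  disjoint : ∀ w w', w ≠ w' → Disjoint (M w) (M w')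
  exists_adj : ∀ w w', H.Adj w w' → ∃ x ∈ M w, ∃ y ∈ M w', G.Adj x y

/-- An edge of `H` is routed inside the union of its two branch sets. Edges with a common end may
overlap in the shared branch set, which a weak drawing permits; disjoint edges use disjoint branch
sets and so do not meet. -/
theorem IsMinorModel.nonempty_weakDrawing {M : W → Set V} (hM : IsMinorModel H G M)
    (D : G.WeakDrawing) : Nonempty H.WeakDrawing := by
  choose r hr using fun w => Set.nonempty_coe_sort.1 (hM.connected w).nonempty
  have key : ∀ w w', H.Adj w w' → ∃ γ : _root_.Path (D.point (r w)) (D.point (r w')),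
      Set.range γ ⊆ D.carrier (M w ∪ M w') := by
    intro w w' h
    obtain ⟨x, hx, y, hy, hxy⟩ := hM.exists_adj w w' h
    exact D.exists_path ((connected_induce_union (hM.connected w).preconnected
      (hM.connected w').preconnected hx hy hxy).preconnected
      ⟨r w, Or.inl (hr w)⟩ ⟨r w', Or.inr (hr w')⟩)
  choose γ hγ using key
  refine ⟨⟨fun w => D.point (r w), fun {w w'} h => γ w w' h, ?_, ?_, ?_⟩⟩
  · intro w w' h
    by_contra hne
    exact Set.disjoint_left.1 (hM.disjoint w w' hne) (hr w) (D.point_injective h ▸ hr w')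
  · intro u v w h hu hv hz
    refine Set.disjoint_left.1 (D.disjoint_carrier (S := M w) ?_) (Or.inl ⟨r w, hr w, rfl⟩)
      (hγ _ _ h hz)
    exact Set.disjoint_union_right.2 ⟨hM.disjoint _ _ hu, hM.disjoint _ _ hv⟩
  · intro u v w x h h' huw hux hvw hvx
    refine (D.disjoint_carrier ?_).mono (hγ _ _ h) (hγ _ _ h')
    simp only [Set.disjoint_union_left, Set.disjoint_union_right]
    exact ⟨⟨hM.disjoint _ _ huw, hM.disjoint _ _ hvw⟩, hM.disjoint _ _ hux, hM.disjoint _ _ hvx⟩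

/-- `K₃,₃`, with the even and the odd numbers below six as its parts. -/
def parityGraph : SimpleGraph (Fin 6) where
  Adj u v := ¬ Even (u.val + v.val)
  symm := ⟨fun u v h => by rwa [add_comm]⟩
  loopless := ⟨fun u h => h ⟨_, rfl⟩⟩

theorem WeakDrawing.not_isMinorModel_parityGraph (D : G.WeakDrawing) (M : Fin 6 → Set V) :
    ¬ IsMinorModel parityGraph G M := fun hM =>
  (hM.nonempty_weakDrawing D).elim
    (WeakDrawing.isEmpty_of_adj_iff_even_add parityGraph fun _ _ => Iff.rfl).false

/-- The graph `G` together with a new vertex adjacent to all vertices of `G`. -/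
def cone (G : SimpleGraph V) : SimpleGraph (Option V) where
  Adj
    | none, none => False
    | none, some _ => True
    | some _, none => True
    | some u, some v => G.Adj u v
  symm := ⟨fun u v h => by
    cases u <;> cases v <;> first | exact h | exact G.adj_symm h⟩
  loopless := ⟨fun u h => by cases u <;> first | exact h | exact G.irrefl h⟩

/-- The apex is a branch set of its own. This turns K₄ and K₂,₃ minors of `G` into K₅ and K₃,₃
minors of its cone. -/
theorem IsMinorModel.cone [Nonempty W] {M : W → Set V} (hM : IsMinorModel H G M) :
    IsMinorModel H.cone G.cone (fun w => w.elim {none} (fun w => some '' M w)) := by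
  constructor
  · rintro (- | w)
    · change (G.cone.induce {none}).Connected
      exact Connected.of_subsingleton
    · let f : G.induce (M w) →g G.cone.induce (some '' M w) :=
        ⟨fun x => ⟨some x.1, x.1, x.2, rfl⟩, fun h => h⟩
      refine (hM.connected w).map f ?_
      rintro ⟨_, x, hx, rfl⟩
      exact ⟨⟨x, hx⟩, rfl⟩
  · rintro (- | w) (- | w') h
    · exact (h rfl).elim
    · simp
    · simp
    · exact (Set.disjoint_image_iff (Option.some_injective V)).2
        (hM.disjoint _ _ (fun h' => h (h' ▸ rfl)))
  · rintro (- | w) (- | w') h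
    · exact h.elim
    · obtain ⟨x, hx⟩ := Set.nonempty_coe_sort.1 (hM.connected w').nonempty
      exact ⟨none, rfl, some x, ⟨x, hx, rfl⟩, trivial⟩
    · obtain ⟨x, hx⟩ := Set.nonempty_coe_sort.1 (hM.connected w).nonempty
      exact ⟨some x, ⟨x, hx, rfl⟩, none, rfl, trivial⟩
    · obtain ⟨x, hx, y, hy, hxy⟩ := hM.exists_adj _ _ h
      exact ⟨some x, ⟨x, hx, rfl⟩, some y, ⟨y, hy, rfl⟩, hxy⟩

theorem PlaneDrawing.isCompact_arc (D : G.PlaneDrawing) (e : G.edgeSet) : IsCompact (D.arc e) := by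
  obtain ⟨e, he⟩ := e
  induction e with
  | _ u v =>
    obtain ⟨γ, -, h⟩ := D.isArc u v he
    rw [← h]
    exact isCompact_range γ.continuous

theorem PlaneDrawing.isCompact_carrier [Finite V] (D : G.PlaneDrawing) : IsCompact D.carrier :=
  (Set.finite_range D.point).isCompact.union (isCompact_iUnion D.isCompact_arc)

theorem PlaneDrawing.IsFace.isOpen [Finite V] {D : G.PlaneDrawing} {F : Set ℂ} (hF : D.IsFace F) :
    IsOpen F := by
  obtain ⟨z, -, rfl⟩ := hF
  exact D.isCompact_carrier.isClosed.isOpen_compl.connectedComponentIn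

theorem PlaneDrawing.IsFace.disjoint_carrier {D : G.PlaneDrawing} {F : Set ℂ} (hF : D.IsFace F) :
    Disjoint F D.carrier := by
  obtain ⟨z, -, rfl⟩ := hF
  exact Set.disjoint_left.2 fun x hx => connectedComponentIn_subset _ _ hx

/-- The apex goes into the face, which is open and connected, hence path connected. A path in the
face comes close to `v` and finishes inside a small ball. There it may hit edges at `v`, and apex
paths may hit each other, but such pairs have a common end. -/
theorem IsOuterplanar.nonempty_weakDrawing_cone [Finite V] (hG : G.IsOuterplanar) :
    Nonempty G.cone.WeakDrawing := by
  obtain ⟨D, F, hF, -, hfr⟩ := hG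
  have hopen := hF.isOpen
  have hdisj := hF.disjoint_carrier
  have hconn : IsConnected F := by
    obtain ⟨z, hz, rfl⟩ := hF
    exact isConnected_connectedComponentIn_iff.2 hz
  obtain ⟨z₀, hz₀⟩ := hconn.nonempty
  have hpc : IsPathConnected F := hopen.isConnected_iff_isPathConnected.1 hconn
  choose γ hγ hr using D.isArc
  have hpt : ∀ v, D.point v ∈ D.carrier := fun v => Or.inl ⟨v, rfl⟩
  have harc : ∀ u v h, Set.range (γ u v h) ⊆ D.carrier := fun u v h z hz =>
    Or.inr (Set.mem_iUnion.2 ⟨_, hr u v h ▸ hz⟩)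
  have key : ∀ v, ∃ δ : _root_.Path z₀ (D.point v),
      (∀ w, w ≠ v → D.point w ∉ Set.range δ) ∧
      ∀ e : G.edgeSet, v ∉ (e : Sym2 V) → Disjoint (Set.range δ) (D.arc e) := by
    intro v
    -- `K` is what the path to `v` must avoid. It is closed by finiteness, so a whole ball around
    -- `v` misses it.
    let K : Set ℂ := D.point '' {w | w ≠ v} ∪
      ⋃ e : {e : G.edgeSet // v ∉ (e : Sym2 V)}, D.arc e.1
    have hK : IsClosed K := (((Set.toFinite _).image _).isCompact.union
      (isCompact_iUnion fun _ => D.isCompact_arc _)).isClosed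
    have hKc : K ⊆ D.carrier := by
      rintro z (⟨w, -, rfl⟩ | hz)
      · exact hpt w
      · obtain ⟨e, he⟩ := Set.mem_iUnion.1 hz
        exact Or.inr (Set.mem_iUnion.2 ⟨_, he⟩)
    have hv : D.point v ∉ K := by
      rintro (⟨w, hw, h⟩ | h)
      · exact hw (D.point_injective h)
      · obtain ⟨e, he⟩ := Set.mem_iUnion.1 h
        exact e.2 (D.mem_of_point_mem_arc _ _ he)
    obtain ⟨ε, hε, hball⟩ := Metric.isOpen_iff.1 hK.isOpen_compl _ hv
    obtain ⟨q, hq, hqF⟩ := mem_closure_iff.1 (frontier_subset_closure (hfr v)) _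
      Metric.isOpen_ball (Metric.mem_ball_self hε)
    have hjF := hpc.joinedIn z₀ hz₀ q hqF
    have hjB : JoinedIn (Metric.ball (D.point v) ε) q (D.point v) :=
      ((convex_ball _ _).isPathConnected ⟨q, hq⟩).joinedIn _ hq _ (Metric.mem_ball_self hε)
    have hsub : Set.range (hjF.somePath.trans hjB.somePath) ⊆ Kᶜ := by
      rw [_root_.Path.trans_range]
      rintro z (⟨t, rfl⟩ | ⟨t, rfl⟩)
      · exact fun h => Set.disjoint_left.1 hdisj (hjF.somePath_mem t) (hKc h)
      · exact hball (hjB.somePath_mem t)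
    refine ⟨_, fun w hw h => hsub h (Or.inl ⟨w, hw, rfl⟩), fun e he => ?_⟩
    exact Set.disjoint_left.2 fun z hz hz' => hsub hz (Or.inr (Set.mem_iUnion.2 ⟨⟨e, he⟩, hz'⟩))
  choose δ hδ hδ' using key
  have hz₀c : z₀ ∉ D.carrier := Set.disjoint_left.1 hdisj hz₀
  let p : Option V → ℂ := fun o => o.elim z₀ D.point
  let P : ∀ {u v : Option V}, G.cone.Adj u v → _root_.Path (p u) (p v) := fun {u v} h =>
    match u, v, h with
    | none, some v, _ => δ v
    | some u, none, _ => (δ u).symm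
    | some u, some v, h => γ u v h
  refine ⟨⟨p, P, ?_, ?_, ?_⟩⟩
  · rintro (- | u) (- | v) h
    · rfl
    · exact (hz₀c ((show z₀ = D.point v from h) ▸ hpt v)).elim
    · exact (hz₀c ((show D.point u = z₀ from h) ▸ hpt u)).elim
    · exact congrArg some (D.point_injective h)
  · have h0 : ∀ u w, some w ≠ some u → D.point w ∉ Set.range (δ u) := fun u w h =>
      hδ u w fun h' => h (congrArg some h')
    rintro (- | u) (- | v) (- | w) h hu hv
    · exact h.elim
    · exact h.elim
    · exact (hu rfl).elim
    · exact h0 v w hv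
    · exact (hv rfl).elim
    · change D.point w ∉ Set.range (δ u).symm
      rw [_root_.Path.symm_range]
      exact h0 u w hu
    · exact fun hz => hz₀c (harc _ _ _ hz)
    · intro hz
      have := D.mem_of_point_mem_arc ⟨s(u, v), h⟩ w (hr u v h ▸ hz)
      rcases Sym2.mem_iff.1 this with rfl | rfl
      · exact hu rfl
      · exact hv rfl
  · have h0 : ∀ u v w (h : G.Adj v w), some u ≠ some v → some u ≠ some w →
        Disjoint (Set.range (δ u)) (Set.range (γ v w h)) := fun u v w h h1 h2 => by
      rw [hr]
      refine hδ' u ⟨s(v, w), h⟩ ?_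
      simp only [Sym2.mem_iff, not_or]
      exact ⟨fun h => h1 (congrArg some h), fun h => h2 (congrArg some h)⟩
    have hs : ∀ u, Set.range (δ u).symm = Set.range (δ u) := fun u => _root_.Path.symm_range _
    rintro (- | u) (- | v) (- | w) (- | x) h h' h1 h2 h3 h4 <;>
      first
      | exact (h1 rfl).elim
      | exact (h2 rfl).elim
      | exact (h3 rfl).elim
      | exact (h4 rfl).elim
      | exact h.elim
      | exact h'.elim
      | exact h0 _ _ _ _ h3 h4
      | exact (h0 _ _ _ _ h2.symm h4.symm).symm
      | skip
    · change Disjoint (Set.range (δ u).symm) _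
      rw [hs]
      exact h0 _ _ _ _ h1 h2
    · change Disjoint _ (Set.range (δ w).symm)
      rw [hs]
      exact (h0 _ _ _ _ h1.symm h3.symm).symm
    · replace h : G.Adj u v := h
      replace h' : G.Adj w x := h'
      change Disjoint (Set.range (γ u v h)) (Set.range (γ w x h'))
      rw [hr, hr, Set.disjoint_left]
      intro z hz hz'
      have hne : ∀ {a b : V}, some a ≠ some b → a ≠ b := fun h h' => h (congrArg some h')
      obtain ⟨y, hy, hy', -⟩ := D.arc_inter_arc ⟨s(u, v), h⟩ ⟨s(w, x), h'⟩
        (by simp [Subtype.ext_iff, hne h1, hne h2]) z hz hz'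
      simp only [Sym2.mem_iff] at hy hy'
      rcases hy with rfl | rfl <;> rcases hy' with rfl | rfl <;> contradiction

theorem IsOuterplanar.not_isMinorModel_top [Finite V] (hG : G.IsOuterplanar) (M : Fin 4 → Set V) :
    ¬ IsMinorModel ⊤ G M := by
  intro hM
  obtain ⟨D⟩ := hG.nonempty_weakDrawing_cone
  obtain ⟨D'⟩ := hM.cone.nonempty_weakDrawing D
  have hadj : ∀ u v : Option (Fin 4), u ≠ v → (⊤ : SimpleGraph (Fin 4)).cone.Adj u v := by
    rintro (- | u) (- | v) h
    · exact h rfl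
    · trivial
    · trivial
    · exact fun h' => h (congrArg some h')
  exact WeakDrawing.isEmpty_top_five.false (D'.comap (H := (⊤ : SimpleGraph (Fin 5)))
    ⟨finSuccEquiv 4, fun h => hadj _ _ ((finSuccEquiv 4).injective.ne h)⟩
    (finSuccEquiv 4).injective)

/-- `K₂,₃`, with the numbers `0` and `1` as one of its parts. -/
def bipartiteTwoThree : SimpleGraph (Fin 5) where
  Adj u v := (u < 2 ∧ 2 ≤ v) ∨ (v < 2 ∧ 2 ≤ u)
  symm := ⟨fun _ _ => Or.symm⟩
  loopless := ⟨fun u h => by omega⟩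

theorem IsOuterplanar.not_isMinorModel_bipartiteTwoThree [Finite V] (hG : G.IsOuterplanar)
    (M : Fin 5 → Set V) : ¬ IsMinorModel bipartiteTwoThree G M := by
  intro hM
  obtain ⟨D⟩ := hG.nonempty_weakDrawing_cone
  obtain ⟨D'⟩ := hM.cone.nonempty_weakDrawing D
  -- The apex joins the part of size two, so that the even indices go to `0`, `1` and the apex, the
  -- odd ones to `2`, `3`, `4`.
  let f : Fin 6 → Option (Fin 5) := ![some 0, some 2, some 1, some 3, none, some 4]
  have hf : Function.Injective f := by decide
  refine (WeakDrawing.isEmpty_of_adj_iff_even_add parityGraph fun _ _ => Iff.rfl).false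
    (D'.comap ⟨f, fun {u v} h => ?_⟩ hf)
  change ¬ Even (u.val + v.val) at h
  fin_cases u <;> fin_cases v <;> simp [f, cone, bipartiteTwoThree] at h ⊢ <;> revert h <;> decide

end SimpleGraph

/-! ### Nonplanar products -/

namespace SimpleGraph

section

variable {V W : Type*} {G : SimpleGraph V} {H : SimpleGraph W}

theorem connected_induce_of_forall_adj {S : Set V} {c : V} (hc : c ∈ S)
    (h : ∀ x ∈ S, x ≠ c → G.Adj c x) : (G.induce S).Connected := by
  rw [connected_iff_exists_forall_reachable]
  refine ⟨⟨c, hc⟩, fun ⟨x, hx⟩ => ?_⟩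
  by_cases hxc : x = c
  · subst hxc; rfl
  · exact Adj.reachable (show (G.induce S).Adj ⟨c, hc⟩ ⟨x, hx⟩ from h x hx hxc)

theorem connected_induce_singleton (G : SimpleGraph V) (v : V) : (G.induce {v}).Connected :=
  connected_induce_of_forall_adj rfl fun _ hx h => (h hx).elim

end

variable {V₁ V₂ W₁ W₂ : Type*} {G₁ : SimpleGraph V₁} {G₂ : SimpleGraph V₂}
  {H₁ : SimpleGraph W₁} {H₂ : SimpleGraph W₂}

theorem Connected.induce_boxProd {S : Set V₁} {T : Set V₂} (hS : (G₁.induce S).Connected)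
    (hT : (G₂.induce T).Connected) : ((G₁ □ G₂).induce (S ×ˢ T)).Connected := by
  let f : ((G₁.induce S) □ (G₂.induce T)) →g ((G₁ □ G₂).induce (S ×ˢ T)) :=
    ⟨fun x => ⟨(x.1, x.2), x.1.2, x.2.2⟩, fun {x y} h => by
      rw [boxProd_adj] at h
      change (G₁ □ G₂).Adj (x.1.1, x.2.1) (y.1.1, y.2.1)
      rw [boxProd_adj]
      exact h.imp (fun h => ⟨h.1, congrArg Subtype.val h.2⟩)
        (fun h => ⟨h.1, congrArg Subtype.val h.2⟩)⟩
  exact (hS.boxProd hT).map f fun ⟨⟨a, b⟩, ha, hb⟩ => ⟨(⟨a, ha⟩, ⟨b, hb⟩), rfl⟩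

/-- Branch sets multiply. Contracting each of two cycles to a triangle therefore contracts their
product to K₃ □ K₃. -/
theorem IsMinorModel.boxProd {M₁ : W₁ → Set V₁} {M₂ : W₂ → Set V₂} (h₁ : IsMinorModel H₁ G₁ M₁)
    (h₂ : IsMinorModel H₂ G₂ M₂) :
    IsMinorModel (H₁ □ H₂) (G₁ □ G₂) fun w => M₁ w.1 ×ˢ M₂ w.2 := by
  refine ⟨fun w => (h₁.connected w.1).induce_boxProd (h₂.connected w.2), ?_, ?_⟩
  · intro w w' h
    rw [Set.disjoint_prod]
    by_cases h1 : w.1 = w'.1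
    · exact Or.inr (h₂.disjoint _ _ fun h2 => h (Prod.ext h1 h2))
    · exact Or.inl (h₁.disjoint _ _ h1)
  · rintro ⟨a, b⟩ ⟨a', b'⟩ h
    rw [boxProd_adj] at h
    obtain ⟨h, rfl : b = b'⟩ | ⟨h, rfl : a = a'⟩ := h
    · obtain ⟨x, hx, y, hy, hxy⟩ := h₁.exists_adj _ _ h
      obtain ⟨z, hz⟩ := Set.nonempty_coe_sort.1 (h₂.connected b).nonempty
      exact ⟨(x, z), ⟨hx, hz⟩, (y, z), ⟨hy, hz⟩, boxProd_adj_left.2 hxy⟩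
    · obtain ⟨x, hx, y, hy, hxy⟩ := h₂.exists_adj _ _ h
      obtain ⟨z, hz⟩ := Set.nonempty_coe_sort.1 (h₁.connected a).nonempty
      exact ⟨(z, x), ⟨hz, hx⟩, (z, y), ⟨hz, hy⟩, boxProd_adj_right.2 hxy⟩

/-- The product of two triangles is not planar. -/
theorem isEmpty_weakDrawing_triangle_boxProd :
    IsEmpty ((⊤ : SimpleGraph (Fin 3)) □ (⊤ : SimpleGraph (Fin 3))).WeakDrawing := by
  refine ⟨fun D => D.not_isMinorModel_parityGraph
    -- Even positions form one side of K₃,₃ and odd positions the other, so the two sides alternate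
    -- in the list.
    ![{(0, 0)}, {(0, 2)}, {(0, 1)}, {(1, 0), (1, 1)}, {(1, 2), (2, 2)}, {(2, 0), (2, 1)}]
    ⟨?_, ?_, ?_⟩⟩
  · intro w
    fin_cases w
    · exact connected_induce_singleton _ _
    · exact connected_induce_singleton _ _
    · exact connected_induce_singleton _ _
    · exact induce_pair_connected_of_adj (by simp [boxProd_adj])
    · exact induce_pair_connected_of_adj (by simp [boxProd_adj])
    · exact induce_pair_connected_of_adj (by simp [boxProd_adj])
  · intro w w' h
    fin_cases w <;> fin_cases w' <;> simp at h ⊢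
  · intro w w' h
    replace h : ¬ Even (w.val + w'.val) := h
    fin_cases w <;> fin_cases w' <;> first | exact (h (by decide)).elim | simp [boxProd_adj]

/-- The product of a claw and a path with three vertices is not planar. -/
theorem isEmpty_weakDrawing_claw_boxProd {A : SimpleGraph V₁} {B : SimpleGraph V₂}
    {c x₀ x₁ x₂ : V₁} (h₀ : A.Adj c x₀) (h₁ : A.Adj c x₁) (h₂ : A.Adj c x₂) (h₀₁ : x₀ ≠ x₁)
    (h₀₂ : x₀ ≠ x₂) (h₁₂ : x₁ ≠ x₂) {b y₀ y₁ : V₂} (hb₀ : B.Adj b y₀) (hb₁ : B.Adj b y₁)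
    (hy : y₀ ≠ y₁) : IsEmpty (A □ B).WeakDrawing := by
  have hstar : (A.induce {c, x₀, x₁, x₂}).Connected := by
    refine connected_induce_of_forall_adj (c := c) (by simp) ?_
    rintro x (rfl | rfl | rfl | rfl) h
    · exact (h rfl).elim
    · exact h₀
    · exact h₁
    · exact h₂
  refine ⟨fun D => D.not_isMinorModel_parityGraph
    -- One side consists of the two outer claws, each contracted, and the centre of the middle claw;
    -- the other consists of the three leaves of the middle claw.
    ![{c, x₀, x₁, x₂} ×ˢ {y₀}, {(x₀, b)}, {(c, b)}, {(x₁, b)}, {c, x₀, x₁, x₂} ×ˢ {y₁},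
      {(x₂, b)}] ⟨?_, ?_, ?_⟩⟩
  · intro w
    fin_cases w
    · exact hstar.induce_boxProd (connected_induce_singleton _ _)
    · exact connected_induce_singleton _ _
    · exact connected_induce_singleton _ _
    · exact connected_induce_singleton _ _
    · exact hstar.induce_boxProd (connected_induce_singleton _ _)
    · exact connected_induce_singleton _ _
  · have hs := hb₀.ne
    have hs' := hb₁.ne
    intro w w' h
    fin_cases w <;> fin_cases w' <;>
      simp [Set.disjoint_prod, h₀.ne, h₁.ne, h₂.ne, h₀.ne', h₁.ne', h₂.ne', h₀₁, h₀₂, h₁₂, h₀₁.symm,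
        h₀₂.symm, h₁₂.symm, hs, hs', hy, hy.symm] at h ⊢
  · intro w w' h
    replace h : ¬ Even (w.val + w'.val) := h
    fin_cases w <;> fin_cases w' <;> first
      | exact (h (by decide)).elim
      | simp [boxProd_adj, h₀, h₁, h₂, hb₀, hb₁, h₀.symm, h₁.symm, h₂.symm, hb₀.symm, hb₁.symm]

/-- A cycle contracts to a triangle. -/
theorem isMinorModel_cycleGraph (m : ℕ) :
    IsMinorModel (⊤ : SimpleGraph (Fin 3)) (cycleGraph (m + 3)) ![{0}, {1}, {i | 2 ≤ i.val}] := by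
  have hadj : ∀ i (h : i + 1 < m + 3),
      (cycleGraph (m + 3)).Adj ⟨i, by omega⟩ ⟨i + 1, h⟩ := fun i h =>
    pathGraph_le_cycleGraph (pathGraph_adj.2 (Or.inl rfl))
  have hlast : (cycleGraph (m + 3)).Adj 0 (Fin.last (m + 2)) := by
    rw [cycleGraph_adj']
    simp
  refine ⟨?_, ?_, ?_⟩
  · intro w
    fin_cases w
    · exact connected_induce_singleton _ _
    · exact connected_induce_singleton _ _
    · change ((cycleGraph (m + 3)).induce {i | 2 ≤ i.val}).Connected
      rw [connected_iff_exists_forall_reachable]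
      refine ⟨⟨⟨2, by omega⟩, show 2 ≤ 2 from le_rfl⟩, ?_⟩
      rintro ⟨⟨i, hi⟩, h2 : 2 ≤ i⟩
      induction i, h2 using Nat.le_induction with
      | base => rfl
      | succ i h2 ih =>
        exact (ih (by omega)).trans (Adj.reachable (hadj i hi))
  · intro w w' h
    fin_cases w <;> fin_cases w' <;> simp at h ⊢
  · intro w w' h
    have h01 : (cycleGraph (m + 3)).Adj 0 1 := hadj 0 (by omega)
    have h12 : ∃ x : Fin (m + 3), 2 ≤ x.val ∧ (cycleGraph (m + 3)).Adj 1 x :=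
      ⟨⟨2, by omega⟩, le_rfl, hadj 1 (by omega)⟩
    have h02 : ∃ x : Fin (m + 3), 2 ≤ x.val ∧ (cycleGraph (m + 3)).Adj 0 x :=
      ⟨Fin.last _, by simp, hlast⟩
    fin_cases w <;> fin_cases w' <;> first
      | exact (h rfl).elim
      | simpa using h01
      | simpa using h01.symm
      | simpa using h12
      | simpa using h02
      | simpa [adj_comm] using h12
      | simpa [adj_comm] using h02

end SimpleGraph

/-! ### Moving a face to infinity; outerplanarity of a factor -/

/-- A punctured disc is the image of a half-plane under `w ↦ z + exp w`. -/
theorem Complex.isPreconnected_ball_diff_center (z : ℂ) {r : ℝ} (hr : 0 < r) :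
    IsPreconnected (Metric.ball z r \ {z}) := by
  have h : Metric.ball z r \ {z} = (fun w => z + Complex.exp w) '' {w | w.re < Real.log r} := by
    ext x
    constructor
    · rintro ⟨hx, hxz⟩
      have hne : x - z ≠ 0 := sub_ne_zero.2 hxz
      refine ⟨Complex.log (x - z), ?_, by simp [Complex.exp_log hne]⟩
      rw [Set.mem_ofPred_eq, Complex.log_re]
      exact Real.log_lt_log (norm_pos_iff.2 hne) (by rwa [Metric.mem_ball, dist_eq_norm] at hx)
    · rintro ⟨w, hw, rfl⟩
      refine ⟨?_, by simp⟩
      rw [Metric.mem_ball, dist_eq_norm, add_sub_cancel_left, Complex.norm_exp]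
      exact (Real.lt_log_iff_exp_lt hr).1 hw
  rw [h]
  exact (convex_halfSpace_re_lt _).isPreconnected.image _ (by fun_prop)

theorem IsPreconnected.diff_singleton_of_isOpen {F : Set ℂ} (hF : IsPreconnected F)
    (ho : IsOpen F) {z : ℂ} (hz : z ∈ F) : IsPreconnected (F \ {z}) := by
  obtain ⟨r, hr, hball⟩ := Metric.isOpen_iff.1 ho z hz
  have hP := Complex.isPreconnected_ball_diff_center z hr
  -- If the punctured ball lies in one part of a separation of `F \ {z}`, then filling in the ball
  -- on that side separates `F`.
  have key : ∀ u v : Set ℂ, IsOpen u → IsOpen v → F \ {z} ⊆ u ∪ v → F \ {z} ∩ (u ∩ v) = ∅ →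
      Metric.ball z r \ {z} ⊆ u → F \ {z} ⊆ u := by
    intro u v hu hv hsub hdisj hPu
    have h1 : F ⊆ (u ∪ Metric.ball z r) ∪ (v \ {z}) := by
      intro x hx
      by_cases hxz : x = z
      · exact Or.inl (Or.inr (hxz ▸ Metric.mem_ball_self hr))
      · exact (hsub ⟨hx, hxz⟩).imp Or.inl fun h => ⟨h, hxz⟩
    have h2 : F ∩ ((u ∪ Metric.ball z r) ∩ (v \ {z})) = ∅ := by
      rw [Set.eq_empty_iff_forall_notMem]
      rintro x ⟨hx, hx', hxv, hxz⟩
      exact Set.eq_empty_iff_forall_notMem.1 hdisj x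
        ⟨⟨hx, hxz⟩, hx'.elim id fun hb => hPu ⟨hb, hxz⟩, hxv⟩
    rcases isPreconnected_iff_subset_of_disjoint.1 hF _ _ (hu.union Metric.isOpen_ball)
      (hv.sdiff isClosed_singleton) h1 h2 with h | h
    · rintro x ⟨hx, hxz⟩
      exact (h hx).elim id fun hb => hPu ⟨hb, hxz⟩
    · exact ((h hz).2 rfl).elim
  rw [isPreconnected_iff_subset_of_disjoint]
  intro u v hu hv hsub hdisj
  have hPF : Metric.ball z r \ {z} ⊆ F \ {z} := Set.sdiff_subset_sdiff_left hball
  rcases isPreconnected_iff_subset_of_disjoint.1 hP u v hu hv (hPF.trans hsub)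
    (Set.subset_empty_iff.1 ((Set.inter_subset_inter_left _ hPF).trans hdisj.subset)) with h | h
  · exact Or.inl (key u v hu hv hsub hdisj h)
  · exact Or.inr (key v u hv hu (by rwa [Set.union_comm]) (by rwa [Set.inter_comm v]) h)

namespace SimpleGraph

variable {V W : Type*} {G : SimpleGraph V} {H : SimpleGraph W}

/-- A drawing of `G` restricts to any graph that maps injectively to `G`. -/
def PlaneDrawing.comap (D : G.PlaneDrawing) (f : H →g G) (hf : Function.Injective f) :
    H.PlaneDrawing where
  point w := D.point (f w)
  arc e := D.arc ⟨Sym2.map f e, f.map_mem_edgeSet e.2⟩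
  point_injective := D.point_injective.comp hf
  isArc v w h := D.isArc (f v) (f w) (f.map_adj h)
  mem_of_point_mem_arc e v h := by
    obtain ⟨w, hw, hwv⟩ := Sym2.mem_map.1 (D.mem_of_point_mem_arc _ _ h)
    exact hf hwv ▸ hw
  arc_inter_arc e e' hne z hz hz' := by
    obtain ⟨v, hv, hv', rfl⟩ := D.arc_inter_arc _ _
      (fun h => hne (Subtype.ext (Sym2.map.injective hf (congrArg Subtype.val h)))) z hz hz'
    obtain ⟨w, hw, rfl⟩ := Sym2.mem_map.1 hv
    obtain ⟨w', hw', h⟩ := Sym2.mem_map.1 hv'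
    exact ⟨w, hw, hf h ▸ hw', rfl⟩

theorem IsPlanar.comap (hG : G.IsPlanar) (f : H →g G) (hf : Function.Injective f) : H.IsPlanar :=
  hG.map fun D => D.comap f hf

theorem PlaneDrawing.arc_subset_carrier (D : G.PlaneDrawing) (e : G.edgeSet) :
    D.arc e ⊆ D.carrier := fun _ hz => Or.inr (Set.mem_iUnion.2 ⟨e, hz⟩)

theorem PlaneDrawing.point_mem_carrier (D : G.PlaneDrawing) (v : V) : D.point v ∈ D.carrier :=
  Or.inl ⟨v, rfl⟩

/-- The image of a drawing under a map that is continuous and injective on it. -/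
def PlaneDrawing.map (D : G.PlaneDrawing) (φ : ℂ → ℂ) (hc : ContinuousOn φ D.carrier)
    (hi : Set.InjOn φ D.carrier) : G.PlaneDrawing where
  point v := φ (D.point v)
  arc e := φ '' D.arc e
  point_injective _ _ h :=
    D.point_injective (hi (D.point_mem_carrier _) (D.point_mem_carrier _) h)
  isArc v w h := by
    obtain ⟨γ, hγ, hr⟩ := D.isArc v w h
    have hsub : Set.range γ ⊆ D.carrier := hr ▸ D.arc_subset_carrier _
    refine ⟨γ.map' (hc.mono hsub), fun s t hst => hγ (hi (hsub ⟨s, rfl⟩) (hsub ⟨t, rfl⟩) hst), ?_⟩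
    rw [← hr, ← Set.range_comp]
    rfl
  mem_of_point_mem_arc e v := by
    rintro ⟨z, hz, hzv⟩
    rw [hi (D.arc_subset_carrier _ hz) (D.point_mem_carrier _) hzv] at hz
    exact D.mem_of_point_mem_arc _ _ hz
  arc_inter_arc e f hef := by
    rintro _ ⟨z, hz, rfl⟩ ⟨z', hz', h⟩
    rw [hi (D.arc_subset_carrier _ hz') (D.arc_subset_carrier _ hz) h] at hz'
    obtain ⟨v, hv, hv', rfl⟩ := D.arc_inter_arc e f hef z hz hz'
    exact ⟨v, hv, hv', rfl⟩

theorem PlaneDrawing.carrier_map (D : G.PlaneDrawing) (φ : ℂ → ℂ) (hc : ContinuousOn φ D.carrier)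
    (hi : Set.InjOn φ D.carrier) : (D.map φ hc hi).carrier = φ '' D.carrier := by
  simp only [carrier, Set.image_union, Set.image_iUnion, ← Set.range_comp]
  rfl

/-- Any face can be made the unbounded face by an inversion. -/
theorem PlaneDrawing.IsFace.isOuterplanar [Finite V] {D : G.PlaneDrawing} {F : Set ℂ}
    (hF : D.IsFace F) (hfr : ∀ v, D.point v ∈ closure F) : G.IsOuterplanar := by
  have hopen := hF.isOpen
  have hdisj := hF.disjoint_carrier
  have hpre : IsPreconnected F := by
    obtain ⟨z, hz, rfl⟩ := hF
    exact isPreconnected_connectedComponentIn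
  obtain ⟨z₀, hz₀⟩ : F.Nonempty := by
    obtain ⟨z, hz, rfl⟩ := hF
    exact ⟨z, mem_connectedComponentIn hz⟩
  -- The centre lies in the face, so `φ` is continuous on the drawing. The convention `0⁻¹ = 0`
  -- makes `φ` injective on all of `ℂ`, but `z₀` must be removed from `F` before taking images.
  let φ : ℂ → ℂ := fun z => (z - z₀)⁻¹
  have hne : ∀ {z}, z ∈ D.carrier → z - z₀ ≠ 0 := fun hz h =>
    Set.disjoint_left.1 hdisj hz₀ (sub_eq_zero.1 h ▸ hz)
  have hcont : ∀ z, z - z₀ ≠ 0 → ContinuousAt φ z := fun z hz =>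
    (continuousAt_id.sub continuousAt_const).inv₀ hz
  have hinj : Function.Injective φ := fun a b h => sub_left_injective (inv_injective h)
  let D' := D.map φ (fun z hz => (hcont z (hne hz)).continuousWithinAt) hinj.injOn
  have hD' : D'.carrier = φ '' D.carrier := D.carrier_map _ _ _
  have himage : φ '' (F \ {z₀}) ⊆ D'.carrierᶜ := by
    rintro _ ⟨z, hz, rfl⟩ h
    rw [hD'] at h
    obtain ⟨w, hw, hwz⟩ := h
    exact Set.disjoint_left.1 hdisj hz.1 (hinj hwz ▸ hw)
  have hpre' : IsPreconnected (φ '' (F \ {z₀})) :=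
    (hpre.diff_singleton_of_isOpen hopen hz₀).image _
      fun z hz => (hcont z (sub_ne_zero.2 hz.2)).continuousWithinAt
  obtain ⟨r, hr, hball⟩ := Metric.isOpen_iff.1 hopen z₀ hz₀
  have hlarge : ∀ t : ℝ, 0 < t → t < r → z₀ + t ∈ F \ {z₀} := fun t ht htr =>
    ⟨hball (by simp [Complex.norm_real, abs_of_pos ht, htr]), by simp [ht.ne']⟩
  have hmem : z₀ + (r / 2 : ℝ) ∈ F \ {z₀} := hlarge _ (by positivity) (by linarith)
  have hface : D'.IsFace (connectedComponentIn D'.carrierᶜ (φ (z₀ + (r / 2 : ℝ)))) :=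
    ⟨_, himage ⟨_, hmem, rfl⟩, rfl⟩
  have hsub := hpre'.subset_connectedComponentIn ⟨_, hmem, rfl⟩ himage
  refine ⟨D', _, hface, ?_, fun v => ?_⟩
  · intro hb
    obtain ⟨C, hC⟩ := (hb.subset hsub).exists_norm_le
    have hC0 : 0 ≤ C := (norm_nonneg _).trans (hC _ ⟨_, hmem, rfl⟩)
    -- A point of `F` this close to `z₀` has an image of norm at least `C + 1`, beyond the supposed
    -- bound `C`.
    have ht : 0 < min (r / 2) (1 / (C + 1)) := by positivity
    have := hC _ ⟨_, hlarge _ ht ((min_le_left _ _).trans_lt (by linarith)), rfl⟩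
    simp only [φ, add_sub_cancel_left, norm_inv, Complex.norm_real, Real.norm_eq_abs,
      abs_of_pos ht] at this
    have h2 : C + 1 ≤ (min (r / 2) (1 / (C + 1)))⁻¹ := by
      rw [le_inv_comm₀ (by positivity) ht, inv_eq_one_div]
      exact min_le_right _ _
    linarith
  · have hv : D.point v ∈ closure (F \ {z₀}) := by
      rw [mem_closure_iff_nhds]
      intro t ht
      have hvz : D.point v ≠ z₀ := sub_ne_zero.1 (hne (D.point_mem_carrier v))
      obtain ⟨y, ⟨hy, hyz⟩, hyF⟩ := mem_closure_iff_nhds.1 (hfr v) _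
        (Filter.inter_mem ht (isOpen_compl_singleton.mem_nhds hvz))
      exact ⟨y, hy, hyF, hyz⟩
    have hv' : D'.point v ∈ closure (connectedComponentIn D'.carrierᶜ (φ (z₀ + (r / 2 : ℝ)))) :=
      closure_mono hsub
        ((hcont _ (hne (D.point_mem_carrier v))).continuousWithinAt.mem_closure_image hv)
    rw [hface.isOpen.frontier_eq]
    exact ⟨hv', fun h => Set.disjoint_left.1 hface.disjoint_carrier h (D'.point_mem_carrier v)⟩

/-- If the product of `B` with a graph that has an edge is planar, then `B` is outerplanar. -/
theorem IsPlanar.isOuterplanar_of_boxProd {A : SimpleGraph V} {B : SimpleGraph W} [Finite W]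
    (hAB : (A □ B).IsPlanar) {a₀ a₁ : V} (ha : A.Adj a₀ a₁) (hB : B.Connected) :
    B.IsOuterplanar := by
  obtain ⟨D⟩ := hAB
  let f₀ : B →g A □ B := (boxProdRight A B a₀).toHom
  have hf₀ : Function.Injective f₀ := (boxProdRight A B a₀).injective
  let D₀ := D.comap f₀ hf₀
  choose γ hγ hr using D.isArc
  have hvert : ∀ b, D.point (a₁, b) ∈ D₀.carrierᶜ := by
    rintro b (⟨b', h⟩ | h)
    · exact ha.ne (congrArg Prod.fst (D.point_injective h))
    · obtain ⟨e, he⟩ := Set.mem_iUnion.1 h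
      obtain ⟨w, -, hw⟩ := Sym2.mem_map.1 (D.mem_of_point_mem_arc _ _ he)
      exact ha.ne (congrArg Prod.fst hw)
  -- An edge not contained in the copy of `B` over `a₀` meets the drawing of this copy only at
  -- vertices of it that are ends of the edge.
  have hcarr : ∀ e : (A □ B).edgeSet, (∃ v ∈ (e : Sym2 (V × W)), v.1 ≠ a₀) → ∀ z ∈ D.arc e,
      z ∈ D₀.carrier → ∃ b, (a₀, b) ∈ (e : Sym2 (V × W)) ∧ z = D.point (a₀, b) := by
    rintro e ⟨v, hve, hv⟩ z hz (⟨b, rfl⟩ | hz')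
    · exact ⟨b, D.mem_of_point_mem_arc _ _ hz, rfl⟩
    · obtain ⟨e₀, he₀⟩ := Set.mem_iUnion.1 hz'
      obtain ⟨w, hw, hw', rfl⟩ := D.arc_inter_arc e _ (fun h => by
        rw [h] at hve
        obtain ⟨b, -, rfl⟩ := Sym2.mem_map.1 hve
        exact hv rfl) z hz he₀
      obtain ⟨b, -, rfl⟩ := Sym2.mem_map.1 hw'
      exact ⟨b, hw, rfl⟩
  let F : W → Set ℂ := fun b => connectedComponentIn D₀.carrierᶜ (D.point (a₁, b))
  -- The copy over `a₁` is connected and disjoint from the drawing of the copy over `a₀`, so it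
  -- stays within one face.
  have hF : ∀ b b', F b = F b' := by
    have hadj : ∀ b b', B.Adj b b' → F b = F b' := by
      intro b b' h
      have h' : (A □ B).Adj (a₁, b) (a₁, b') := boxProd_adj_right.2 h
      have hsub : Set.range (γ _ _ h') ⊆ D₀.carrierᶜ := by
        intro z hz hz'
        rw [hr] at hz
        obtain ⟨c, hc, -⟩ := hcarr ⟨_, h'⟩ ⟨_, Sym2.mem_mk_left _ _, ha.ne'⟩ z hz hz'
        rcases Sym2.mem_iff.1 hc with hc | hc <;> exact ha.ne (congrArg Prod.fst hc)
      exact connectedComponentIn_eq ((isPreconnected_range (γ _ _ h').continuous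
        ).subset_connectedComponentIn ⟨0, (γ _ _ h').source⟩ hsub ⟨1, (γ _ _ h').target⟩)
    intro b b'
    obtain ⟨q⟩ := hB.preconnected b b'
    induction q with
    | nil => rfl
    | cons h _ ih => exact (hadj _ _ h).trans ih
  have hcl : ∀ b, D.point (a₀, b) ∈ closure (F b) := by
    intro b
    have h : (A □ B).Adj (a₀, b) (a₁, b) := boxProd_adj_left.2 ha
    -- Without its end `(a₀, b)`, the rung lies in the common face; hence that end lies in the
    -- closure of the face.
    have himage : (γ _ _ h).extend '' Set.Ioc 0 1 ⊆ D₀.carrierᶜ := by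
      rintro _ ⟨t, ht, rfl⟩ hz
      rw [(γ _ _ h).extend_apply ⟨ht.1.le, ht.2⟩] at hz
      have hmem : (γ _ _ h) ⟨t, ht.1.le, ht.2⟩ ∈ D.arc ⟨s((a₀, b), (a₁, b)), h⟩ := by
        rw [← hr _ _ h]
        exact ⟨_, rfl⟩
      obtain ⟨c, hc, hzc⟩ := hcarr ⟨_, h⟩ ⟨_, Sym2.mem_mk_right _ _, ha.ne'⟩ _ hmem hz
      rcases Sym2.mem_iff.1 hc with hc | hc
      · rw [hc] at hzc
        exact ht.1.ne' (congrArg Subtype.val (hγ _ _ h (hzc.trans (γ _ _ h).source.symm)))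
      · exact ha.ne (congrArg Prod.fst hc)
    have hsub : (γ _ _ h).extend '' Set.Ioc 0 1 ⊆ F b :=
      (isPreconnected_Ioc.image _ (γ _ _ h).continuous_extend.continuousOn
        ).subset_connectedComponentIn ⟨1, by simp, by simp⟩ himage
    refine closure_mono hsub (image_closure_subset_closure_image (γ _ _ h).continuous_extend
      ⟨0, ?_, by simp⟩)
    rw [closure_Ioc zero_ne_one]
    exact ⟨le_rfl, zero_le_one⟩
  obtain ⟨b₀⟩ := hB.nonempty
  have hface : D₀.IsFace (F b₀) := ⟨_, hvert b₀, rfl⟩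
  exact hface.isOuterplanar fun b => hF b b₀ ▸ hcl b

end SimpleGraph

/-! ### Hamiltonian cycles and noncrossing chords -/

namespace SimpleGraph

variable {V : Type*} {G : SimpleGraph V}

theorem connected_induce_of_isChain {l : List V} (hl : l ≠ []) (h : l.IsChain G.Adj) :
    (G.induce {v | v ∈ l}).Connected := by
  have := (Walk.ofSupport l hl h).connected_induce_support
  rwa [Walk.support_ofSupport] at this

theorem connected_induce_image_Ico {f : ℕ → V} {a b : ℕ} (hab : a < b)
    (h : ∀ i, a ≤ i → i + 1 < b → G.Adj (f i) (f (i + 1))) :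
    (G.induce (f '' Set.Ico a b)).Connected := by
  rw [connected_iff_exists_forall_reachable]
  refine ⟨⟨f a, a, ⟨le_rfl, hab⟩, rfl⟩, ?_⟩
  rintro ⟨_, i, ⟨hai, hib⟩, rfl⟩
  induction i, hai using Nat.le_induction with
  | base => rfl
  | succ i hai ih =>
    exact (ih (by omega)).trans (Adj.reachable
      (show (G.induce _).Adj ⟨f i, _⟩ ⟨f (i + 1), _⟩ from h i hai hib))

theorem IsKConnected.connected {k : ℕ} (hG : G.IsKConnected k) (hk : 0 < k) : G.Connected := by
  have h := hG.2 ∅ (by simpa using hk)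
  rw [Set.compl_empty] at h
  exact (induceUnivIso G).connected_iff.1 h

/-- The vertices of a cycle, in their cyclic order. The two ends of an edge are allowed. -/
structure IsCyclicList (G : SimpleGraph V) (l : List V) : Prop where
  nodup : l.Nodup
  isChain : l.IsChain G.Adj
  adj : ∀ x ∈ l.getLast?, ∀ y ∈ l.head?, G.Adj x y

theorem IsCyclicList.append_comm {l₁ l₂ : List V} (h : G.IsCyclicList (l₁ ++ l₂)) :
    G.IsCyclicList (l₂ ++ l₁) := by
  rcases eq_or_ne l₁ [] with rfl | h₁
  · simpa using h
  rcases eq_or_ne l₂ [] with rfl | h₂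
  · simpa using h
  obtain ⟨hn, hc, ha⟩ := h
  rw [List.isChain_append] at hc
  rw [List.getLast?_append_of_ne_nil _ h₂, List.head?_append_of_ne_nil _ h₁] at ha
  refine ⟨List.nodup_append_comm.1 hn, List.isChain_append.2 ⟨hc.2.1, hc.1, ha⟩, ?_⟩
  rw [List.getLast?_append_of_ne_nil _ h₁, List.head?_append_of_ne_nil _ h₂]
  exact hc.2.2

/-- An ear whose ends attach to the last and the first vertex of the list is spliced into the
closing edge. Rotation by `IsCyclicList.append_comm` brings the required edge to this place. -/
theorem IsCyclicList.append {l e : List V} (hl : G.IsCyclicList l) (hl₀ : l ≠ []) (he₀ : e ≠ [])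
    (hn : e.Nodup) (hc : e.IsChain G.Adj) (hd : ∀ a ∈ e, a ∉ l)
    (h₁ : ∀ x ∈ l.getLast?, ∀ a ∈ e.head?, G.Adj x a)
    (h₂ : ∀ a ∈ e.getLast?, ∀ y ∈ l.head?, G.Adj a y) : G.IsCyclicList (l ++ e) := by
  refine ⟨List.nodup_append.2 ⟨hl.nodup, hn, ?_⟩, List.isChain_append.2 ⟨hl.isChain, hc, h₁⟩, ?_⟩
  · rintro a ha b hb rfl
    exact hd a hb ha
  · rwa [List.getLast?_append_of_ne_nil _ he₀, List.head?_append_of_ne_nil _ hl₀]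

/-- The walk is cut just before it first enters `S`. -/
theorem Walk.exists_walk_notMem {S : Set V} {v y₀ : V} (q : G.Walk v y₀) (hv : v ∉ S)
    (hy₀ : y₀ ∈ S) : ∃ w y, ∃ q' : G.Walk v w, (∀ u ∈ q'.support, u ∉ S) ∧ y ∈ S ∧ G.Adj w y ∧
      y ∈ q.support := by
  induction q with
  | nil => exact (hv hy₀).elim
  | @cons a b c h q ih =>
    by_cases hb : b ∈ S
    · exact ⟨a, b, nil, by simpa using hv, hb, h, by simp⟩
    · obtain ⟨w, y, q', hq', hy, hwy, hyq⟩ := ih hb hy₀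
      refine ⟨w, y, cons h q', ?_, hy, hwy, by simp [hyq]⟩
      simpa using ⟨hv, hq'⟩

/-- In a `2`-connected graph, a cycle that misses a vertex has an ear. -/
theorem IsKConnected.exists_ear (hG : G.IsKConnected 2) {l : List V} (hl : l.Nodup)
    (hlen : 2 ≤ l.length) {v₀ : V} (hv₀ : v₀ ∉ l) : ∃ x ∈ l, ∃ y ∈ l, x ≠ y ∧ ∃ e : List V,
      e ≠ [] ∧ e.Nodup ∧ e.IsChain G.Adj ∧ (∀ a ∈ e.head?, G.Adj x a) ∧
      (∀ a ∈ e.getLast?, G.Adj a y) ∧ ∀ a ∈ e, a ∉ l := by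
  classical
  have hother : ∀ x, ∃ y ∈ l, y ≠ x := by
    intro x
    by_contra! h
    have h1 : l ⊆ [x] := fun y hy => by simp [h y hy]
    have := (hl.subperm h1).length_le
    simp at this
    omega
  obtain ⟨z, hz, -⟩ := hother v₀
  obtain ⟨q₀⟩ := (hG.connected two_pos).preconnected z v₀
  obtain ⟨⟨⟨x, v⟩, hxv⟩, -, hx, hv⟩ := q₀.exists_boundary_dart {a | a ∈ l} hz hv₀
  replace hx : x ∈ l := hx
  replace hv : v ∉ l := hv
  obtain ⟨y₀, hy₀, hyx⟩ := hother x
  -- The edge `x v` leaves the cycle. After deleting `x`, a walk leads from `v` back to the cycle,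
  -- so its first vertex `y` there differs from `x`.
  have hcon := hG.2 {x} (by simp)
  obtain ⟨q⟩ := hcon.preconnected ⟨v, fun h => hv (h ▸ hx)⟩ ⟨y₀, hyx⟩
  obtain ⟨w, y, q', hq', hy, hwy, hyq⟩ :=
    (q.map (Embedding.induce {x}ᶜ).toHom).exists_walk_notMem (S := {a | a ∈ l}) hv hy₀
  refine ⟨x, hx, y, hy, ?_, q'.bypass.support, q'.bypass.support_ne_nil,
    q'.bypass_isPath.support_nodup, q'.bypass.isChain_adj_support, ?_, ?_, ?_⟩
  · rintro rfl
    rw [Walk.support_map, List.mem_map] at hyq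
    obtain ⟨a, -, ha⟩ := hyq
    exact a.2 ha
  · rw [List.head?_eq_some_head (Walk.support_ne_nil _), Walk.head_support]
    rintro a ⟨⟩
    exact hxv
  · rw [List.getLast?_eq_some_getLast (Walk.support_ne_nil _), Walk.getLast_support]
    rintro a ⟨⟩
    exact hwy
  · exact fun a ha => hq' a (q'.support_bypass_subset_support ha)

/-- In a `2`-connected graph without a `K₂,₃` minor, every cycle that misses a vertex can be made
longer. -/
theorem IsCyclicList.exists_length_lt (hG : G.IsKConnected 2)
    (hM : ∀ M, ¬ IsMinorModel bipartiteTwoThree G M) {l : List V} (hl : G.IsCyclicList l)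
    (hlen : 2 ≤ l.length) {v₀ : V} (hv₀ : v₀ ∉ l) :
    ∃ l', G.IsCyclicList l' ∧ l.length < l'.length := by
  obtain ⟨x, hx, y, hy, hxy, e, he, hen, hec, hex, hey, hel⟩ := hG.exists_ear hl.nodup hlen hv₀
  obtain ⟨s, t, rfl⟩ := List.append_of_mem hx
  have hl' := hl.append_comm
  have hy' : y ∈ t ++ s := by
    simp only [List.mem_append, List.mem_cons] at hy ⊢
    rcases hy with h | h | h
    · exact Or.inr h
    · exact (hxy h.symm).elim
    · exact Or.inl h
  obtain ⟨m₁, m₂, hm⟩ := List.append_of_mem hy'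
  rw [List.cons_append, hm] at hl'
  have hlen' : (s ++ x :: t).length = (x :: (m₁ ++ y :: m₂)).length := by
    rw [← hm]
    simp
    omega
  have hel' : ∀ a ∈ e, a ≠ x ∧ a ∉ m₁ ∧ a ≠ y ∧ a ∉ m₂ := by
    intro a ha
    have h1 := hel a ha
    have h2 : a ∉ t ++ s := fun h => h1 (by
      simp only [List.mem_append, List.mem_cons] at h ⊢
      tauto)
    rw [hm] at h2
    simp only [List.mem_append, List.mem_cons, not_or] at h1 h2
    tauto
  rw [hlen']
  have hepos : 0 < e.length := List.length_pos_iff.2 he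
  -- The rotated cycle is `x, m₁, y, m₂`. If `m₁` or `m₂` is empty, the ear replaces the edge
  -- between `x` and `y`. Otherwise `m₁`, `m₂` and the ear each touch both `x` and `y`, giving K₂,₃.
  rcases eq_or_ne m₁ [] with rfl | h₁
  · have hl'' : G.IsCyclicList ((y :: m₂) ++ [x]) := IsCyclicList.append_comm (l₁ := [x]) hl'
    refine ⟨_, hl''.append (e := e) (by simp) he hen hec ?_ ?_ ?_, by simp; omega⟩
    · intro a ha
      have := hel' a ha
      simp only [List.mem_append, List.mem_cons]
      grind
    · simpa [List.getLast?_cons] using hex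
    · simpa using hey
  rcases eq_or_ne m₂ [] with rfl | h₂
  · refine ⟨_, hl'.append (e := e.reverse) (by simp) (by simpa) (by simpa) ?_ ?_ ?_ ?_,
      by simp; omega⟩
    · rw [List.isChain_reverse]
      exact hec.imp fun _ _ h => h.symm
    · intro a ha
      have := hel' a (by simpa using ha)
      simp only [List.mem_append, List.mem_cons]
      grind
    · rw [← List.cons_append, List.getLast?_append_of_ne_nil _ (by simp)]
      simpa [adj_comm] using hey
    · simpa [adj_comm] using hex
  exfalso
  obtain ⟨hn, hc, ha⟩ := hl'
  rw [List.isChain_cons, List.isChain_append, List.isChain_cons,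
    List.head?_append_of_ne_nil _ h₁] at hc
  obtain ⟨hc₁, hc₂, ⟨hc₃, hc₄⟩, hc₅⟩ := hc
  have hlast : (x :: (m₁ ++ y :: m₂)).getLast? = m₂.getLast? := by
    rw [List.append_cons, ← List.cons_append, List.getLast?_append_of_ne_nil _ h₂]
  rw [hlast] at ha
  simp only [List.head?_cons, Option.mem_some_iff, forall_eq'] at ha hc₅
  have hmem : ∀ {m : List V}, m ≠ [] → (∃ a ∈ m.head?, a ∈ m) ∧ ∃ a ∈ m.getLast?, a ∈ m :=
    fun {m} h => ⟨⟨m.head h, List.head?_eq_some_head h, List.head_mem h⟩,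
      ⟨m.getLast h, List.getLast?_eq_some_getLast h, List.getLast_mem h⟩⟩
  obtain ⟨⟨p₁, hp₁, hp₁'⟩, ⟨q₁, hq₁, hq₁'⟩⟩ := hmem h₁
  obtain ⟨⟨p₂, hp₂, hp₂'⟩, ⟨q₂, hq₂, hq₂'⟩⟩ := hmem h₂
  obtain ⟨⟨p₃, hp₃, hp₃'⟩, ⟨q₃, hq₃, hq₃'⟩⟩ := hmem he
  simp only [List.nodup_cons, List.nodup_append, List.mem_append, List.mem_cons, not_or] at hn
  refine hM ![{x}, {y}, {a | a ∈ m₁}, {a | a ∈ m₂}, {a | a ∈ e}] ⟨?_, ?_, ?_⟩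
  · intro w
    fin_cases w
    · exact connected_induce_singleton _ _
    · exact connected_induce_singleton _ _
    · exact connected_induce_of_isChain h₁ hc₂
    · exact connected_induce_of_isChain h₂ hc₄
    · exact connected_induce_of_isChain he hec
  · have hd : ∀ i j : Fin 5, i < j → Disjoint
        ((![{x}, {y}, {a | a ∈ m₁}, {a | a ∈ m₂}, {a | a ∈ e}] : Fin 5 → Set V) i)
        ((![{x}, {y}, {a | a ∈ m₁}, {a | a ∈ m₂}, {a | a ∈ e}] : Fin 5 → Set V) j) := by
      intro i j hij
      rw [Set.disjoint_left]
      fin_cases i <;> fin_cases j <;> first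
        | exact absurd hij (by decide)
        | (simp; grind)
    intro i j hij
    rcases hij.lt_or_gt with h | h
    · exact hd i j h
    · exact (hd j i h).symm
  · have hd : ∀ i j : Fin 5, i < 2 → 2 ≤ j →
        ∃ u ∈ (![{x}, {y}, {a | a ∈ m₁}, {a | a ∈ m₂}, {a | a ∈ e}] : Fin 5 → Set V) i,
        ∃ v ∈ (![{x}, {y}, {a | a ∈ m₁}, {a | a ∈ m₂}, {a | a ∈ e}] : Fin 5 → Set V) j,
          G.Adj u v := by
      intro i j hi hj
      fin_cases i <;> fin_cases j <;> first
        | exact absurd hi (by decide)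
        | exact absurd hj (by decide)
        | skip
      · exact ⟨x, rfl, p₁, hp₁', hc₁ _ hp₁⟩
      · exact ⟨x, rfl, q₂, hq₂', (ha _ hq₂).symm⟩
      · exact ⟨x, rfl, p₃, hp₃', hex _ hp₃⟩
      · exact ⟨y, rfl, q₁, hq₁', (hc₅ _ hq₁).symm⟩
      · exact ⟨y, rfl, p₂, hp₂', hc₃ _ hp₂⟩
      · exact ⟨y, rfl, q₃, hq₃', (hey _ hq₃).symm⟩
    rintro i j (h | h)
    · exact hd i j h.1 h.2
    · obtain ⟨u, hu, v, hv, huv⟩ := hd j i h.1 h.2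
      exact ⟨v, hv, u, hu, huv.symm⟩

/-- A `2`-connected graph without a `K₂,₃` minor is Hamiltonian. -/
theorem IsKConnected.exists_isCyclicList [Finite V] (hG : G.IsKConnected 2)
    (hM : ∀ M, ¬ IsMinorModel bipartiteTwoThree G M) :
    ∃ l, G.IsCyclicList l ∧ ∀ v, v ∈ l := by
  have key : ∀ k, ∀ l, G.IsCyclicList l → 2 ≤ l.length → Nat.card V - l.length = k →
      ∃ l, G.IsCyclicList l ∧ ∀ v, v ∈ l := by
    intro k
    induction k using Nat.strong_induction_on with
    | _ k ih =>
      intro l hl h2 hk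
      by_cases h : ∀ v, v ∈ l
      · exact ⟨l, hl, h⟩
      push Not at h
      obtain ⟨v, hv⟩ := h
      obtain ⟨l', hl', hlt⟩ := hl.exists_length_lt hG hM h2 hv
      have : Fintype V := Fintype.ofFinite V
      have hcard := hl'.nodup.length_le_card
      rw [← Nat.card_eq_fintype_card] at hcard
      exact ih _ (by omega) l' hl' (by omega) rfl
  have hnt : Nontrivial V := by
    rw [← Finite.one_lt_card_iff_nontrivial]
    have := hG.1
    rw [ENat.card_eq_coe_natCard] at this
    have : 2 < Nat.card V := by exact_mod_cast this
    omega
  obtain ⟨v⟩ := (hG.connected two_pos).nonempty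
  obtain ⟨w, h⟩ := (hG.connected two_pos).preconnected.exists_adj_of_nontrivial v
  exact key _ [v, w] ⟨by simp [h.ne], by simp [h], by simp [h.symm]⟩ (by simp) rfl

/-- The vertices of a `2`-connected outerplanar graph can be ordered so that no two edges cross. -/
theorem IsOuterplanar.exists_equiv [Finite V] (hG : G.IsOuterplanar) (hG₂ : G.IsKConnected 2) :
    ∃ (n : ℕ) (e : V ≃ Fin n), ∀ a b c d : V, e a < e b → e b < e c → e c < e d → G.Adj a c →
      ¬ G.Adj b d := by
  classical
  obtain ⟨l, hl, hmem⟩ := hG₂.exists_isCyclicList hG.not_isMinorModel_bipartiteTwoThree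
  let E := hl.nodup.getEquivOfForallMemList l hmem
  refine ⟨l.length, E.symm, fun a b c d hab hbc hcd hac hbd => ?_⟩
  -- Indexing by `ℕ` makes segments of the cycle into intervals; the default `a` occurs only beyond
  -- the length and is never used.
  let f : ℕ → V := fun i => if h : i < l.length then l[i] else a
  have hf : ∀ i (hi : i < l.length), f i = E ⟨i, hi⟩ := fun i hi => by simp [f, E, hi]
  have hE : ∀ v, f (E.symm v) = v := fun v => by rw [hf _ (E.symm v).2, E.apply_symm_apply]
  have hinj : ∀ i j, i < l.length → j < l.length → f i = f j → i = j := by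
    intro i j hi hj h
    rw [hf i hi, hf j hj] at h
    exact congrArg Fin.val (E.injective h)
  have hadj : ∀ i, i + 1 < l.length → G.Adj (f i) (f (i + 1)) := by
    intro i hi
    simp only [f, hi, dif_pos, show i < l.length by omega]
    exact hl.isChain.getElem i hi
  have hlast : G.Adj (f (l.length - 1)) (f 0) := by
    have h0 : 0 < l.length := List.length_pos_of_mem (hmem a)
    have h1 : l.length - 1 < l.length := by omega
    simp only [f, h0, h1, dif_pos]
    exact hl.adj _ (by simp [List.getLast?_eq_getElem?]) _ (by simp [List.head?_eq_getElem?])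
  rw [← hE a, ← hE c] at hac
  rw [← hE b, ← hE d] at hbd
  have hm := (E.symm d).2
  rw [Fin.lt_def] at hab hbc hcd
  generalize (E.symm a).val = i at *
  generalize (E.symm b).val = j at *
  generalize (E.symm c).val = k at *
  generalize (E.symm d).val = m at *
  clear hE hf E
  clear_value f
  generalize l.length = n at *
  have hS : ∀ p q, p < q → q ≤ n → (G.induce (f '' Set.Ico p q)).Connected := fun p q hpq hq =>
    connected_induce_image_Ico hpq fun r _ hr => hadj r (by omega)
  have hdisj : ∀ S T : Set ℕ, (∀ p ∈ S, p < n) → (∀ p ∈ T, p < n) → Disjoint S T →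
      Disjoint (f '' S) (f '' T) := by
    intro S T hS hT hST
    rw [Set.disjoint_left]
    rintro _ ⟨p, hp, rfl⟩ ⟨q, hq, hpq⟩
    exact Set.disjoint_left.1 hST hp (hinj q p (hT q hq) (hS p hp) hpq ▸ hq)
  have hconn : (G.induce (f '' (Set.Ico m n ∪ Set.Ico 0 i))).Connected := by
    rcases Nat.eq_zero_or_pos i with rfl | h0
    · rw [Set.Ico_self, Set.union_empty]
      exact hS m n hm le_rfl
    · rw [Set.image_union]
      exact connected_induce_union (hS m n hm le_rfl).preconnected
        (hS 0 i h0 (by omega)).preconnected ⟨n - 1, ⟨by omega, by omega⟩, rfl⟩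
        ⟨0, ⟨le_rfl, h0⟩, rfl⟩ hlast
  -- The ends of the two chords start four segments of the cycle, the last one wrapping around.
  -- Consecutive segments are joined along the cycle and opposite ones by the chords, so they model
  -- K₄.
  let S : Fin 4 → Set ℕ := ![Set.Ico i j, Set.Ico j k, Set.Ico k m, Set.Ico m n ∪ Set.Ico 0 i]
  refine hG.not_isMinorModel_top (fun w => f '' S w) ⟨?_, ?_, ?_⟩
  · intro w
    fin_cases w
    · exact hS i j hab (by omega)
    · exact hS j k hbc (by omega)
    · exact hS k m hcd (by omega)
    · exact hconn
  · have hlt : ∀ w, ∀ p ∈ S w, p < n := by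
      intro w p hp
      fin_cases w <;> simp [S] at hp <;> omega
    intro w w' h
    refine hdisj _ _ (hlt w) (hlt w') (Set.disjoint_left.2 fun p hp hp' => ?_)
    fin_cases w <;> fin_cases w' <;> first
      | exact h rfl
      | (simp [S] at hp hp'; omega)
  · have hstep : ∀ p q, p + 1 = q → q < n → G.Adj (f p) (f q) := by
      rintro p _ rfl h
      exact hadj p h
    have hnm : ∃ q ∈ S 3, G.Adj (f q) (f i) := by
      rcases Nat.eq_zero_or_pos i with rfl | h0
      · exact ⟨n - 1, Or.inl ⟨by omega, by omega⟩, hlast⟩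
      · exact ⟨i - 1, Or.inr ⟨by omega, by omega⟩, hstep _ _ (by omega) (by omega)⟩
    have hd : ∀ w w' : Fin 4, w < w' → ∃ u ∈ f '' S w, ∃ v ∈ f '' S w', G.Adj u v := by
      intro w w' h
      have h0 : i ∈ S 0 := ⟨le_rfl, hab⟩
      have h1 : j ∈ S 1 := ⟨le_rfl, hbc⟩
      have h2 : k ∈ S 2 := ⟨le_rfl, hcd⟩
      have h3 : m ∈ S 3 := Or.inl ⟨le_rfl, hm⟩
      have h0' : j - 1 ∈ S 0 := ⟨by omega, by omega⟩
      have h1' : k - 1 ∈ S 1 := ⟨by omega, by omega⟩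
      have h2' : m - 1 ∈ S 2 := ⟨by omega, by omega⟩
      obtain ⟨q, hq, hqi⟩ := hnm
      fin_cases w <;> fin_cases w' <;> first
        | exact absurd h (by decide)
        | skip
      · exact ⟨_, ⟨_, h0', rfl⟩, _, ⟨_, h1, rfl⟩, hstep _ _ (by omega) (by omega)⟩
      · exact ⟨_, ⟨_, h0, rfl⟩, _, ⟨_, h2, rfl⟩, hac⟩
      · exact ⟨_, ⟨_, h0, rfl⟩, _, ⟨_, hq, rfl⟩, hqi.symm⟩
      · exact ⟨_, ⟨_, h1', rfl⟩, _, ⟨_, h2, rfl⟩, hstep _ _ (by omega) (by omega)⟩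
      · exact ⟨_, ⟨_, h1, rfl⟩, _, ⟨_, h3, rfl⟩, hbd⟩
      · exact ⟨_, ⟨_, h2', rfl⟩, _, ⟨_, h3, rfl⟩, hstep _ _ (by omega) (by omega)⟩
    intro w w' h
    rcases (show w ≠ w' from h).lt_or_gt with h | h
    · exact hd w w' h
    · obtain ⟨u, hu, v, hv, huv⟩ := hd w' w h
      exact ⟨v, hv, u, hu, huv.symm⟩

end SimpleGraph

/-! ### A plane drawing of K₂ □ B -/

theorem Complex.continuous_mk {X : Type*} [TopologicalSpace X] {f g : X → ℝ} (hf : Continuous f)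
    (hg : Continuous g) : Continuous fun t => (⟨f t, g t⟩ : ℂ) :=
  Complex.equivRealProdCLM.symm.continuous.comp (hf.prodMk hg)

namespace SimpleGraph

/-- The set `T` is a simple arc that joins the points `a` and `b`. -/
def IsArcBetween (a b : ℂ) (T : Set ℂ) : Prop :=
  ∃ γ : _root_.Path a b, Function.Injective γ ∧ Set.range γ = T

theorem IsArcBetween.symm {a b : ℂ} {T : Set ℂ} (h : IsArcBetween a b T) : IsArcBetween b a T := by
  obtain ⟨γ, hγ, hr⟩ := h
  refine ⟨γ.symm, ?_, by rw [_root_.Path.symm_range, hr]⟩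
  exact hγ.comp unitInterval.symm_bijective.injective

theorem isArcBetween_image_Icc {f : ℝ → ℂ} (hf : Continuous f) {s t : ℝ} (hst : s < t)
    (hi : Set.InjOn f (Set.Icc s t)) : IsArcBetween (f s) (f t) (f '' Set.Icc s t) := by
  have hmem : ∀ r : unitInterval, s + r * (t - s) ∈ Set.Icc s t := fun r => by
    have h0 := r.2.1
    have h1 := r.2.2
    constructor <;> nlinarith
  refine ⟨⟨⟨fun r => f (s + r * (t - s)), by fun_prop⟩, by simp, by simp⟩, ?_, ?_⟩
  · intro a b h
    have := hi (hmem a) (hmem b) h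
    rw [add_right_inj, mul_eq_mul_right_iff] at this
    exact Subtype.ext (this.resolve_right (by linarith))
  · ext z
    constructor
    · rintro ⟨r, rfl⟩
      exact ⟨_, hmem r, rfl⟩
    · rintro ⟨x, ⟨hx, hx'⟩, rfl⟩
      have hts : 0 < t - s := by linarith
      refine ⟨⟨(x - s) / (t - s), by apply div_nonneg <;> linarith,
        (div_le_one hts).2 (by linarith)⟩, ?_⟩
      change f (s + (x - s) / (t - s) * (t - s)) = f x
      rw [div_mul_cancel₀ _ hts.ne']
      ring_nf

/-- Arcs are naturally described after orienting an edge. The relation `R` accommodates this: an arc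
is chosen for each unordered edge only at the end, since all admissible arcs satisfy the drawing
conditions. -/
theorem isPlanar_of_relation {V : Type*} {G : SimpleGraph V} {p : V → ℂ}
    (hp : Function.Injective p) (R : Sym2 V → Set ℂ → Prop) (hR : ∀ e ∈ G.edgeSet, ∃ T, R e T)
    (harc : ∀ e T, R e T → ∃ a b, e = s(a, b) ∧ IsArcBetween (p a) (p b) T)
    (hpt : ∀ e T, R e T → ∀ v, p v ∈ T → v ∈ e)
    (hinter : ∀ e T f T', R e T → R f T' → e ≠ f → ∀ z ∈ T, z ∈ T' →
      ∃ v, v ∈ e ∧ v ∈ f ∧ z = p v) : G.IsPlanar := by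
  choose! T hT using hR
  refine ⟨⟨p, fun e => T e, hp, ?_, fun e => hpt _ _ (hT e e.2), fun e f hne =>
    hinter _ _ _ _ (hT e e.2) (hT f f.2) fun h => hne (Subtype.ext h)⟩⟩
  intro v w h
  obtain ⟨a, b, hab, h'⟩ := harc _ _ (hT s(v, w) h)
  rcases Sym2.eq_iff.1 hab with ⟨rfl, rfl⟩ | ⟨rfl, rfl⟩
  · exact h'
  · exact h'.symm

/-- The arches have the same leading coefficient, so arches over nested intervals are nested.
Intervals that do not cross are nested or have no interior point in common, so arches can touch only
at shared ends. -/
theorem eq_of_parabola_eq {p q r t x : ℝ} (hpq : p < q) (hrt : r < t) (hpx : p ≤ x) (hxq : x ≤ q)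
    (hrx : r ≤ x) (hxt : x ≤ t) (h : (x - p) * (q - x) = (x - r) * (t - x))
    (h₁ : ¬ (p < r ∧ r < q ∧ q < t)) (h₂ : ¬ (r < p ∧ p < t ∧ t < q)) (hne : ¬ (p = r ∧ q = t)) :
    (x = p ∨ x = q) ∧ (x = r ∨ x = t) := by
  have key : ∀ p q r t : ℝ, p < q → r < t → p ≤ x → x ≤ q → r ≤ x → x ≤ t → p ≤ r → t ≤ q →
      (x - p) * (q - x) = (x - r) * (t - x) → ¬ (p = r ∧ q = t) →
      (x = p ∨ x = q) ∧ (x = r ∨ x = t) := by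
    intro p q r t hpq hrt hpx hxq hrx hxt hpr htq h hne
    -- The difference of the parabolas is affine in `x`. It is interpolated from its values at `r`
    -- and `t`, both nonnegative when `[r, t] ⊆ [p, q]`.
    have e : (t - x) * ((r - p) * (q - r)) + (x - r) * ((t - p) * (q - t)) = 0 := by
      linear_combination (t - r) * h
    have e1 : 0 ≤ (t - x) * ((r - p) * (q - r)) := by
      apply mul_nonneg (by linarith) (mul_nonneg _ _) <;> linarith
    have e2 : 0 ≤ (x - r) * ((t - p) * (q - t)) := by
      apply mul_nonneg (by linarith) (mul_nonneg _ _) <;> linarith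
    have e3 : (t - x) * ((r - p) * (q - r)) = 0 := by linarith
    have e4 : (x - r) * ((t - p) * (q - t)) = 0 := by linarith
    have hqr : q - r ≠ 0 := by linarith
    have htp : t - p ≠ 0 := by linarith
    simp only [mul_eq_zero, hqr, htp, or_false, false_or, sub_eq_zero] at e3 e4
    grind
  rcases le_total p r with hpr | hpr
  · rcases le_or_gt q r with hqr | hqr
    · exact ⟨Or.inr (by linarith), Or.inl (by linarith)⟩
    · rcases le_or_gt t q with htq | htq
      · exact key p q r t hpq hrt hpx hxq hrx hxt hpr htq h hne
      · rcases hpr.lt_or_eq with hpr | hpr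
        · exact (h₁ ⟨hpr, hqr, htq⟩).elim
        · exact (key r t p q hrt hpq hrx hxt hpx hxq hpr.ge htq.le h.symm
            fun h => hne ⟨h.1.symm, h.2.symm⟩).symm
  · rcases le_or_gt t p with htp | htp
    · exact ⟨Or.inl (by linarith), Or.inr (by linarith)⟩
    · rcases le_or_gt q t with hqt | hqt
      · exact (key r t p q hrt hpq hrx hxt hpx hxq hpr hqt h.symm
          fun h => hne ⟨h.1.symm, h.2.symm⟩).symm
      · rcases hpr.lt_or_eq with hpr | hpr
        · exact (h₂ ⟨hpr, htp, hqt⟩).elim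
        · exact key p q r t hpq hrt hpx hxq hrx hxt hpr.ge hqt.le h hne

/-- If the vertices of `B` can be put on a line so that edges in a half-plane do not cross, then
the product of `B` and an edge is planar: the two copies of `B` are drawn in two half-planes. -/
theorem isPlanar_top_boxProd {β : Type*} {B : SimpleGraph β} {n : ℕ} (e : β ≃ Fin n)
    (he : ∀ a b c d : β, e a < e b → e b < e c → e c < e d → B.Adj a c → ¬ B.Adj b d) :
    ((⊤ : SimpleGraph (Fin 2)) □ B).IsPlanar := by
  let x : β → ℝ := fun b => (e b : ℕ)
  have hx : ∀ {a b}, x a = x b → a = b := fun {a b} h =>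
    e.injective (Fin.ext (Nat.cast_injective (R := ℝ) h))
  have hlt : ∀ {a b}, x a < x b ↔ e a < e b := fun {a b} => by simp [x]
  let p : Fin 2 × β → ℂ := fun v => ⟨x v.2, -(v.1 : ℕ)⟩
  -- Copy `0` sits at height `0` with arches upwards, copy `1` at height `-1` with arches downwards.
  -- The strip between them is left to the rungs, and `hchord` says that an arch meets it only at
  -- its ends.
  let chord : Fin 2 → β → β → ℝ → ℂ := fun i a b t =>
    ⟨t, -(i : ℕ) + (1 - 2 * (i : ℕ)) * ((t - x a) * (x b - t))⟩
  have hp : Function.Injective p := by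
    rintro ⟨i, b⟩ ⟨j, c⟩ h
    obtain ⟨h1, h2⟩ := Complex.ext_iff.1 h
    simp only [p, neg_inj, Nat.cast_inj] at h1 h2
    exact Prod.ext (Fin.ext h2) (hx h1)
  let R : Sym2 (Fin 2 × β) → Set ℂ → Prop := fun f T =>
    (∃ b, f = s((1, b), (0, b)) ∧ T = (fun y : ℝ => (⟨x b, y⟩ : ℂ)) '' Set.Icc (-1) 0) ∨
    ∃ i a b, B.Adj a b ∧ x a < x b ∧ f = s((i, a), (i, b)) ∧ T = chord i a b '' Set.Icc (x a) (x b)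
  have hchord : ∀ i a b t, t ∈ Set.Icc (x a) (x b) → (chord i a b t).im ∈ Set.Icc (-1 : ℝ) 0 →
      (t = x a ∨ t = x b) ∧ (chord i a b t).im = -(i : ℕ) := by
    rintro i a b t ⟨h1, h2⟩ ⟨h3, h4⟩
    have h5 : 0 ≤ (t - x a) * (x b - t) := mul_nonneg (by linarith) (by linarith)
    have h6 : (t - x a) * (x b - t) = 0 := by
      fin_cases i <;> simp [chord] at h3 h4 <;> linarith
    refine ⟨?_, by simp [chord, h6]⟩
    rcases mul_eq_zero.1 h6 with h | h
    · exact Or.inl (by linarith)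
    · exact Or.inr (by linarith)
  refine isPlanar_of_relation hp R ?_ ?_ ?_ ?_
  · intro f
    induction f with
    | _ u v =>
      obtain ⟨i, a⟩ := u
      obtain ⟨j, b⟩ := v
      intro h
      rw [mem_edgeSet, boxProd_adj] at h
      obtain ⟨h, rfl : a = b⟩ | ⟨h, rfl : i = j⟩ := h
      · refine ⟨_, Or.inl ⟨a, ?_, rfl⟩⟩
        have : i ≠ j := h
        rw [Sym2.eq_iff]
        grind
      · rcases lt_or_gt_of_ne (fun hab => h.ne (hx hab) : x a ≠ x b) with h' | h'
        · exact ⟨_, Or.inr ⟨i, a, b, h, h', rfl, rfl⟩⟩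
        · exact ⟨_, Or.inr ⟨i, b, a, h.symm, h', Sym2.eq_swap, rfl⟩⟩
  · rintro f T (⟨b, rfl, rfl⟩ | ⟨i, a, b, -, h, rfl, rfl⟩)
    · refine ⟨_, _, rfl, ?_⟩
      have := isArcBetween_image_Icc (f := fun y : ℝ => (⟨x b, y⟩ : ℂ)) ?_ neg_one_lt_zero ?_
      · simpa [p] using this
      · exact Complex.continuous_mk continuous_const continuous_id
      · exact fun s _ t _ hst => congrArg Complex.im hst
    · refine ⟨_, _, rfl, ?_⟩
      have := isArcBetween_image_Icc (f := chord i a b) ?_ h ?_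
      · simpa [p, chord] using this
      · exact Complex.continuous_mk continuous_id (by fun_prop)
      · exact fun s _ t _ hst => congrArg Complex.re hst
  · rintro f T (⟨b, rfl, rfl⟩ | ⟨i, a, b, -, h, rfl, rfl⟩) ⟨j, c⟩
    · rintro ⟨y, -, hy⟩
      obtain rfl : b = c := hx (congrArg Complex.re hy)
      fin_cases j <;> simp
    · rintro ⟨t, ht, htv⟩
      obtain ⟨h1, h2⟩ := hchord i a b t ht (htv ▸ by fin_cases j <;> simp [p])
      have hre : t = x c := congrArg Complex.re htv
      have him : -((i : ℕ) : ℝ) = -(j : ℕ) := h2.symm.trans (congrArg Complex.im htv)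
      obtain rfl : i = j := Fin.ext (by exact_mod_cast neg_injective him)
      rw [hre] at h1
      rcases h1 with h1 | h1 <;> simp [hx h1]
  · have hrc : ∀ b i a c z, x a < x c → z ∈ (fun y : ℝ => (⟨x b, y⟩ : ℂ)) '' Set.Icc (-1) 0 →
        z ∈ chord i a c '' Set.Icc (x a) (x c) →
        ∃ v : Fin 2 × β, v ∈ s(((1 : Fin 2), b), ((0 : Fin 2), b)) ∧ v ∈ s((i, a), (i, c)) ∧
          z = p v := by
      rintro b i a c _ h ⟨y, hy, rfl⟩ ⟨t, ht, hty⟩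
      obtain ⟨h1, h2⟩ := hchord i a c t ht (hty ▸ hy)
      have hre : t = x b := congrArg Complex.re hty
      have him : y = -(i : ℕ) := (congrArg Complex.im hty).symm.trans h2
      refine ⟨(i, b), by fin_cases i <;> simp, ?_, by simp [p, him]⟩
      rw [hre] at h1
      rcases h1 with h1 | h1 <;> simp [hx h1]
    rintro f T g T' (⟨b, rfl, rfl⟩ | ⟨i, a, b, hab, h, rfl, rfl⟩)
      (⟨d, rfl, rfl⟩ | ⟨j, c, d, hcd, h', rfl, rfl⟩) hne z hz hz'
    · obtain ⟨y, -, rfl⟩ := hz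
      obtain ⟨y', -, hy⟩ := hz'
      exact (hne (by rw [hx (congrArg Complex.re hy)])).elim
    · exact hrc b j c d z h' hz hz'
    · obtain ⟨v, hv, hv', hzv⟩ := hrc d i a b z h hz' hz
      exact ⟨v, hv', hv, hzv⟩
    · obtain ⟨t, ht, rfl⟩ := hz
      obtain ⟨t', ht', htt⟩ := hz'
      obtain rfl : t' = t := congrArg Complex.re htt
      have him : -((j : ℕ) : ℝ) + (1 - 2 * (j : ℕ)) * ((t' - x c) * (x d - t')) =
        -(i : ℕ) + (1 - 2 * (i : ℕ)) * ((t' - x a) * (x b - t')) := congrArg Complex.im htt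
      have h1 : 0 ≤ (t' - x a) * (x b - t') := mul_nonneg (by linarith [ht.1]) (by linarith [ht.2])
      have h2 : 0 ≤ (t' - x c) * (x d - t') :=
        mul_nonneg (by linarith [ht'.1]) (by linarith [ht'.2])
      obtain rfl : i = j := by
        fin_cases i <;> fin_cases j <;> simp at him ⊢ <;> linarith
      have heq : (t' - x a) * (x b - t') = (t' - x c) * (x d - t') := by
        have h0 : (1 - 2 * (i : ℕ) : ℝ) ≠ 0 := by fin_cases i <;> norm_num
        exact (mul_left_cancel₀ h0 (add_left_cancel him)).symm
      obtain ⟨h3, h4⟩ := eq_of_parabola_eq h h' ht.1 ht.2 ht'.1 ht'.2 heq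
        (fun hh => he a c b d (hlt.1 hh.1) (hlt.1 hh.2.1) (hlt.1 hh.2.2) hab hcd)
        (fun hh => he c a d b (hlt.1 hh.1) (hlt.1 hh.2.1) (hlt.1 hh.2.2) hcd hab)
        (fun hh => hne (by rw [hx hh.1, hx hh.2]))
      have hz : chord i a b t' = ⟨t', -(i : ℕ)⟩ := by
        refine Complex.ext rfl ?_
        simp only [chord]
        rcases h3 with h3 | h3 <;> simp [h3]
      rw [hz]
      rcases h3 with rfl | rfl
      · exact ⟨(i, a), by simp, by rcases h4 with h4 | h4 <;> simp [hx h4], rfl⟩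
      · exact ⟨(i, b), by simp, by rcases h4 with h4 | h4 <;> simp [hx h4], rfl⟩

end SimpleGraph

/-! ### A plane drawing of the product of a path and a cycle -/

namespace SimpleGraph

theorem val_eq_of_cycleGraph_adj {k : ℕ} {i j : Fin k} (h : (cycleGraph k).Adj i j) :
    j.val = (i.val + 1) % k ∨ i.val = (j.val + 1) % k := by
  rw [cycleGraph_adj'] at h
  have hi := i.2
  have hj := j.2
  simp only [Fin.sub_def] at h
  rcases h with h | h
  · right
    rcases lt_or_ge i.val j.val with hij | hij
    · rw [Nat.mod_eq_of_lt (by omega)] at h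
      have : j.val + 1 = k := by omega
      rw [this, Nat.mod_self]
      omega
    · rw [show k - j.val + i.val = (i.val - j.val) + k by omega, Nat.add_mod_right,
        Nat.mod_eq_of_lt (by omega)] at h
      rw [Nat.mod_eq_of_lt (by omega)]
      omega
  · left
    rcases lt_or_ge j.val i.val with hij | hij
    · rw [Nat.mod_eq_of_lt (by omega)] at h
      have : i.val + 1 = k := by omega
      rw [this, Nat.mod_self]
      omega
    · rw [show k - i.val + j.val = (j.val - i.val) + k by omega, Nat.add_mod_right,
        Nat.mod_eq_of_lt (by omega)] at h
      rw [Nat.mod_eq_of_lt (by omega)]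
      omega

/-- The product of a path and a cycle is planar: the copies of the cycle are drawn as concentric
circles. -/
theorem isPlanar_pathGraph_boxProd_cycleGraph (n : ℕ) {k : ℕ} (hk : 3 ≤ k) :
    (pathGraph n □ cycleGraph k).IsPlanar := by
  have hk0 : (0 : ℝ) < k := by
    have : 0 < k := by omega
    exact_mod_cast this
  -- These are polar coordinates with the full turn scaled to length `k`: vertex `i` of the cycle is
  -- at `x = i`, and `x = k` is the same as `x = 0`. Level `i` of the path gets radius `i + 1`, so
  -- that no circle degenerates.
  let Φ : ℝ → ℝ → ℂ := fun r x => r * Complex.exp ((2 * Real.pi * (x / k) : ℝ) * Complex.I)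
  have hnorm : ∀ r x, 0 < r → ‖Φ r x‖ = r := fun r x hr => by
    rw [norm_mul, Complex.norm_exp_ofReal_mul_I, mul_one, Complex.norm_real,
      Real.norm_of_nonneg hr.le]
  have hΦ : ∀ {r r' x x' : ℝ}, 0 < r → 0 < r' → Φ r x = Φ r' x' →
      r = r' ∧ ∃ m : ℤ, x = x' + m * k := by
    intro r r' x x' hr hr' h
    have hrr : r = r' := by rw [← hnorm r x hr, h, hnorm r' x' hr']
    subst hrr
    refine ⟨rfl, ?_⟩
    have h1 := mul_left_cancel₀ (Complex.ofReal_ne_zero.2 hr.ne') h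
    obtain ⟨m, hm⟩ := Complex.exp_eq_exp_iff_exists_int.1 h1
    refine ⟨m, ?_⟩
    have h2 : ((2 * Real.pi * (x / k) : ℝ) : ℂ) =
        ((2 * Real.pi * (x' / k) + m * (2 * Real.pi) : ℝ) : ℂ) := by
      apply mul_right_cancel₀ Complex.I_ne_zero
      rw [hm]
      push_cast
      ring
    have h3 := Complex.ofReal_injective h2
    have hpi := Real.pi_pos
    field_simp at h3
    nlinarith
  have hΦ' : ∀ {r r' x x' : ℝ}, 0 < r → 0 < r' → 0 ≤ x → x ≤ k → 0 ≤ x' → x' ≤ k → Φ r x = Φ r' x' →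
      r = r' ∧ (x = x' ∨ (x = 0 ∧ x' = k) ∨ (x = k ∧ x' = 0)) := by
    intro r r' x x' hr hr' h0 h1 h2 h3 h
    obtain ⟨hrr, m, hm⟩ := hΦ hr hr' h
    refine ⟨hrr, ?_⟩
    have hm1 : m ≤ 1 := by
      by_contra hc
      have : (2 : ℝ) ≤ m := by exact_mod_cast (by omega : (2 : ℤ) ≤ m)
      nlinarith
    have hm2 : -1 ≤ m := by
      by_contra hc
      have : (m : ℝ) ≤ -2 := by exact_mod_cast (by omega : m ≤ (-2 : ℤ))
      nlinarith
    obtain rfl | rfl | rfl : m = -1 ∨ m = 0 ∨ m = 1 := by omega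
    · exact Or.inr (Or.inl ⟨by push_cast at hm; linarith, by push_cast at hm; linarith⟩)
    · exact Or.inl (by simpa using hm)
    · exact Or.inr (Or.inr ⟨by push_cast at hm; linarith, by push_cast at hm; linarith⟩)
  have hΦk : ∀ r, Φ r k = Φ r 0 := fun r => by
    simp only [Φ, div_self hk0.ne']
    simp [Complex.exp_two_pi_mul_I]
  let p : Fin n × Fin k → ℂ := fun v => Φ ((v.1 : ℕ) + 1) (v.2 : ℕ)
  have hpos : ∀ j : ℕ, (0 : ℝ) < j + 1 := fun j => by positivity
  have hval : ∀ i : Fin k, ((i : ℕ) : ℝ) < k := fun i => by exact_mod_cast i.2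
  have hnn : ∀ i : ℕ, (0 : ℝ) ≤ i := fun i => by positivity
  let next : Fin k → Fin k := fun i => ⟨(i.val + 1) % k, Nat.mod_lt _ (by omega)⟩
  have hnext : ∀ r (i : Fin k), Φ r ((i : ℕ) + 1) = Φ r (next i : ℕ) := by
    intro r i
    have hi := i.2
    rcases Nat.lt_or_ge (i.val + 1) k with h | h
    · simp [next, Nat.mod_eq_of_lt h]
    · have h' : i.val + 1 = k := by omega
      have h'' : ((i : ℕ) : ℝ) + 1 = k := by exact_mod_cast h'
      simp [next, h', h'', hΦk]
  have hang : ∀ (b c : Fin k) r r', 0 < r → 0 < r' → Φ r (b : ℕ) = Φ r' (c : ℕ) →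
      r = r' ∧ b = c := by
    intro b c r r' hr hr' h
    obtain ⟨h1, h2⟩ := hΦ' hr hr' (hnn b) (hval b).le (hnn c) (hval c).le h
    refine ⟨h1, Fin.ext ?_⟩
    rcases h2 with h2 | h2 | h2
    · exact_mod_cast h2
    · exact absurd h2.2 (hval c).ne
    · exact absurd h2.1 (hval b).ne
  have hp : Function.Injective p := by
    rintro ⟨i, b⟩ ⟨j, c⟩ h
    obtain ⟨h1, h2⟩ := hang b c _ _ (hpos i) (hpos j) h
    exact Prod.ext (Fin.ext (by exact_mod_cast add_right_cancel h1)) h2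
  have hlev : ∀ i j l : Fin n, j.val = i.val + 1 →
      ((l : ℕ) : ℝ) + 1 ∈ Set.Icc (((i : ℕ) : ℝ) + 1) ((j : ℕ) + 1) → l = i ∨ l = j := by
    intro i j l hij hl
    have h1 : i.val + 1 ≤ l.val + 1 := by exact_mod_cast hl.1
    have h2 : l.val + 1 ≤ j.val + 1 := by exact_mod_cast hl.2
    simp only [Fin.ext_iff]
    omega
  have hadj : ∀ (m m' : Fin k) x, m < m' → x ∈ Set.Icc ((m : ℕ) : ℝ) ((m : ℕ) + 1) →
      x ∈ Set.Icc ((m' : ℕ) : ℝ) ((m' : ℕ) + 1) → x = (m' : ℕ) ∧ m' = next m := by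
    intro m m' x h hx hx'
    have h1 : m'.val ≤ m.val + 1 := by exact_mod_cast hx'.1.trans hx.2
    have h2 : m'.val = m.val + 1 := by
      have : m.val < m'.val := h
      omega
    refine ⟨le_antisymm ?_ hx'.1, Fin.ext ?_⟩
    · rw [h2]
      exact_mod_cast hx.2
    · rw [show (next m).val = (m.val + 1) % k from rfl, ← h2, Nat.mod_eq_of_lt m'.2]
  have hon : ∀ (i : Fin k) (m : Fin k) x r r', 0 < r → 0 < r' →
      x ∈ Set.Icc ((m : ℕ) : ℝ) ((m : ℕ) + 1) →
      Φ r (i : ℕ) = Φ r' x → r = r' ∧ (i = m ∨ i = next m) := by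
    intro i m x r r' hr hr' hx h
    have hmk : ((m : ℕ) : ℝ) + 1 ≤ k := by exact_mod_cast m.2
    obtain ⟨h1, h2⟩ := hΦ' hr hr' (hnn i) (hval i).le ((hnn m).trans hx.1) (hx.2.trans hmk) h
    refine ⟨h1, ?_⟩
    rcases h2 with h2 | h2 | h2
    · rw [← h2] at hx
      have h3 : m.val ≤ i.val := by exact_mod_cast hx.1
      have h4 : i.val ≤ m.val + 1 := by exact_mod_cast hx.2
      rcases h3.eq_or_lt with h5 | h5
      · exact Or.inl (Fin.ext h5.symm)
      · right
        have h6 : i.val = m.val + 1 := by omega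
        exact Fin.ext (by
          rw [show (next m).val = (m.val + 1) % k from rfl, ← h6, Nat.mod_eq_of_lt i.2])
    · right
      have h3 : k ≤ m.val + 1 := by
        have := hx.2
        rw [h2.2] at this
        exact_mod_cast this
      have h4 : m.val + 1 = k := by
        have := m.2
        omega
      have h5 : i.val = 0 := by exact_mod_cast h2.1
      exact Fin.ext (by rw [show (next m).val = (m.val + 1) % k from rfl, h4, Nat.mod_self, h5])
    · exact absurd h2.1 (hval i).ne
  let R : Sym2 (Fin n × Fin k) → Set ℂ → Prop := fun f T =>
    (∃ (i j : Fin n) (b : Fin k), j.val = i.val + 1 ∧ f = s((i, b), (j, b)) ∧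
      T = (fun r : ℝ => Φ r (b : ℕ)) '' Set.Icc ((i : ℕ) + 1) ((j : ℕ) + 1)) ∨
    ∃ (i : Fin n) (b : Fin k), f = s((i, b), (i, next b)) ∧
      T = (fun x : ℝ => Φ ((i : ℕ) + 1) x) '' Set.Icc (b : ℕ) ((b : ℕ) + 1)
  refine isPlanar_of_relation hp R ?_ ?_ ?_ ?_
  · intro f
    induction f with
    | _ u v =>
      obtain ⟨i, a⟩ := u
      obtain ⟨j, b⟩ := v
      intro h
      rw [mem_edgeSet, boxProd_adj] at h
      obtain ⟨h, rfl : a = b⟩ | ⟨h, rfl : i = j⟩ := h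
      · rcases pathGraph_adj.1 h with h | h
        · exact ⟨_, Or.inl ⟨i, j, a, h.symm, rfl, rfl⟩⟩
        · exact ⟨_, Or.inl ⟨j, i, a, h.symm, Sym2.eq_swap, rfl⟩⟩
      · rcases val_eq_of_cycleGraph_adj h with h | h
        · obtain rfl : b = next a := Fin.ext h
          exact ⟨_, Or.inr ⟨i, a, rfl, rfl⟩⟩
        · obtain rfl : a = next b := Fin.ext h
          exact ⟨_, Or.inr ⟨i, b, Sym2.eq_swap, rfl⟩⟩
  · rintro f T (⟨i, j, b, hij, rfl, rfl⟩ | ⟨i, b, rfl, rfl⟩)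
    · refine ⟨_, _, rfl, ?_⟩
      refine isArcBetween_image_Icc (f := fun r : ℝ => Φ r (b : ℕ)) (by fun_prop) ?_ ?_
      · rw [hij]
        push_cast
        linarith
      · intro r hr r' hr' h
        have := hpos i
        exact (hΦ (by linarith [hr.1]) (by linarith [hr'.1]) h).1
    · refine ⟨_, _, rfl, ?_⟩
      have h := isArcBetween_image_Icc (f := fun x : ℝ => Φ ((i : ℕ) + 1) x)
        (s := (b : ℕ)) (t := (b : ℕ) + 1) (by fun_prop) (by linarith) ?_
      · rw [hnext] at h
        exact h
      · intro x hx x' hx' h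
        have hbk : ((b : ℕ) : ℝ) + 1 ≤ k := by exact_mod_cast b.2
        -- An interval of length one cannot contain both `0` and `k`, so the arc does not close up.
        have hk3 : (3 : ℝ) ≤ k := by exact_mod_cast hk
        have hb := hnn b
        obtain ⟨-, h | h | h⟩ := hΦ' (hpos i) (hpos i) (hb.trans hx.1) (hx.2.trans hbk)
          (hb.trans hx'.1) (hx'.2.trans hbk) h
        · exact h
        · linarith [hx.1, hx'.2]
        · linarith [hx.2, hx'.1]
  · rintro f T (⟨i, j, b, hij, rfl, rfl⟩ | ⟨i, b, rfl, rfl⟩) ⟨l, c⟩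
    · rintro ⟨r, hr, h⟩
      obtain ⟨rfl, rfl⟩ := hang b c r _ (by linarith [hr.1, hpos i]) (hpos l) h
      rcases hlev i j l hij hr with rfl | rfl <;> simp
    · rintro ⟨x, hx, h⟩
      obtain ⟨h1, h2⟩ := hon c b x _ _ (hpos l) (hpos i) hx h.symm
      obtain rfl : l = i := Fin.ext (by exact_mod_cast add_right_cancel h1)
      rcases h2 with rfl | rfl <;> simp
  · have hrr : ∀ (i j i' j' : Fin n) (b : Fin k) r, j.val = i.val + 1 → j'.val = i'.val + 1 →
        r ∈ Set.Icc (((i : ℕ) : ℝ) + 1) ((j : ℕ) + 1) →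
        r ∈ Set.Icc (((i' : ℕ) : ℝ) + 1) ((j' : ℕ) + 1) → i < i' →
        j = i' ∧ Φ r (b : ℕ) = p (i', b) := by
      intro i j i' j' b r hij hij' hr hr' h
      have h1 : i'.val + 1 ≤ j.val + 1 := by exact_mod_cast hr'.1.trans hr.2
      have h2 : j = i' := Fin.ext (by have : i.val < i'.val := h; omega)
      subst h2
      rw [le_antisymm hr.2 hr'.1]
      exact ⟨rfl, rfl⟩
    have hrc : ∀ (i j l : Fin n) (b m : Fin k) z, j.val = i.val + 1 →
        z ∈ (fun r : ℝ => Φ r (b : ℕ)) '' Set.Icc ((i : ℕ) + 1) ((j : ℕ) + 1) →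
        z ∈ (fun x : ℝ => Φ ((l : ℕ) + 1) x) '' Set.Icc (m : ℕ) ((m : ℕ) + 1) →
        ∃ v, v ∈ s((i, b), (j, b)) ∧ v ∈ s((l, m), (l, next m)) ∧ z = p v := by
      rintro i j l b m _ hij ⟨r, hr, rfl⟩ ⟨x, hx, h⟩
      obtain ⟨rfl, h2⟩ := hon b m x r _ (by linarith [hr.1, hpos i]) (hpos l) hx h.symm
      refine ⟨(l, b), ?_, ?_, rfl⟩
      · rcases hlev i j l hij hr with rfl | rfl <;> simp
      · rcases h2 with rfl | rfl <;> simp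
    rintro f T g T' (⟨i, j, b, hij, rfl, rfl⟩ | ⟨i, b, rfl, rfl⟩)
      (⟨i', j', b', hij', rfl, rfl⟩ | ⟨i', b', rfl, rfl⟩) hne z hz hz'
    · obtain ⟨r, hr, rfl⟩ := hz
      obtain ⟨r', hr', h⟩ := hz'
      obtain ⟨rfl, rfl⟩ := hang b' b r' r (by linarith [hr'.1, hpos i'])
        (by linarith [hr.1, hpos i]) h
      rcases lt_trichotomy i i' with h | rfl | h
      · obtain ⟨rfl, h2⟩ := hrr i j i' j' b' r' hij hij' hr hr' h
        exact ⟨_, by simp, by simp, h2⟩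
      · obtain rfl : j = j' := Fin.ext (by omega)
        exact (hne rfl).elim
      · obtain ⟨rfl, h2⟩ := hrr i' j' i j b' r' hij' hij hr' hr h
        exact ⟨_, by simp, by simp, h2⟩
    · exact hrc i j i' b b' z hij hz hz'
    · obtain ⟨v, hv, hv', hzv⟩ := hrc i' j' i b' b z hij' hz' hz
      exact ⟨v, hv', hv, hzv⟩
    · obtain ⟨x, hx, rfl⟩ := hz
      obtain ⟨x', hx', h⟩ := hz'
      have hbk : ((b : ℕ) : ℝ) + 1 ≤ k := by exact_mod_cast b.2
      have hbk' : ((b' : ℕ) : ℝ) + 1 ≤ k := by exact_mod_cast b'.2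
      obtain ⟨h1, h2⟩ := hΦ' (hpos i) (hpos i') ((hnn b).trans hx.1) (hx.2.trans hbk)
        ((hnn b').trans hx'.1) (hx'.2.trans hbk') h.symm
      obtain rfl : i = i' := Fin.ext (by exact_mod_cast add_right_cancel h1)
      have hbb : b ≠ b' := fun hbb => hne (by rw [hbb])
      have hwrap : ∀ b b' : Fin k, (0 : ℝ) ∈ Set.Icc ((b : ℕ) : ℝ) ((b : ℕ) + 1) →
          (k : ℝ) ∈ Set.Icc ((b' : ℕ) : ℝ) ((b' : ℕ) + 1) → b.val = 0 ∧ b = next b' := by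
        intro b b' h0 hk
        have h3 : b.val = 0 := by
          have : b.val ≤ 0 := by exact_mod_cast h0.1
          omega
        have h4 : k ≤ b'.val + 1 := by exact_mod_cast hk.2
        have h5 : b'.val + 1 = k := by
          have := b'.2
          omega
        exact ⟨h3, Fin.ext (by
          rw [show (next b').val = (b'.val + 1) % k from rfl, h5, Nat.mod_self, h3])⟩
      rcases h2 with rfl | ⟨rfl, rfl⟩ | ⟨rfl, rfl⟩
      · rcases hbb.lt_or_gt with hlt | hlt
        · obtain ⟨rfl, rfl⟩ := hadj b b' x hlt hx hx'
          exact ⟨(i, next b), by simp, by simp, rfl⟩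
        · obtain ⟨rfl, rfl⟩ := hadj b' b x hlt hx' hx
          exact ⟨(i, next b'), by simp, by simp, rfl⟩
      · obtain ⟨h3, rfl⟩ := hwrap b b' hx hx'
        exact ⟨(i, next b'), by simp, by simp, by simp only [p, h3, Nat.cast_zero]⟩
      · obtain ⟨h3, rfl⟩ := hwrap b' b hx' hx
        exact ⟨(i, next b), by simp, by simp, by simp only [p, h3, Nat.cast_zero, hΦk]⟩

end SimpleGraph

/-! ### Connectivity of products, paths and cycles -/

namespace SimpleGraph

section

variable {V W : Type*} {G : SimpleGraph V} {H : SimpleGraph W}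

theorem IsKConnected.of_iso (e : G ≃g H) {k : ℕ} (hG : G.IsKConnected k) : H.IsKConnected k := by
  refine ⟨ENat.card_congr e.toEquiv ▸ hG.1, fun S hS => ?_⟩
  have h := hG.2 (e ⁻¹' S) (by
    rw [← e.toEquiv.injective.encard_image]
    exact (Set.encard_le_encard (Set.image_preimage_subset _ _)).trans_lt hS)
  let f : G.induce (e ⁻¹' S)ᶜ →g H.induce Sᶜ := ⟨fun x => ⟨e x, x.2⟩, fun h => e.map_adj_iff.2 h⟩
  refine h.map f fun ⟨y, hy⟩ => ⟨⟨e.symm y, ?_⟩, Subtype.ext (e.apply_symm_apply y)⟩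
  simpa using hy

/-- All vertices of a `3`-connected graph have at least three neighbours. -/
theorem IsKConnected.exists_adj_ne (hG : G.IsKConnected 3) (v x y : V) :
    ∃ w, G.Adj v w ∧ w ≠ x ∧ w ≠ y := by
  by_contra! h
  -- Removing `v` from the deleted set keeps `v` in the graph even if it equals `x` or `y`. In the
  -- connected remainder `v` still has a neighbour.
  have hS : (({x, y} : Set V) \ {v}).encard < 3 :=
    (Set.encard_le_encard Set.sdiff_subset).trans_lt
      ((Set.encard_insert_le _ _).trans_lt (by rw [Set.encard_singleton]; norm_num))
  have hcon := hG.2 _ hS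
  have hw : ∃ w, w ∉ ({v, x, y} : Set V) := by
    by_contra! hall
    have h1 : ENat.card V ≤ 3 := by
      rw [← Set.encard_univ, ← Set.eq_univ_of_forall hall]
      refine (Set.encard_insert_le _ _).trans ?_
      calc ({x, y} : Set V).encard + 1 ≤ (1 + 1) + 1 := by
            gcongr
            exact (Set.encard_insert_le _ _).trans (by rw [Set.encard_singleton])
        _ = 3 := by norm_num
    exact absurd hG.1 (not_lt.2 h1)
  obtain ⟨w, hw⟩ := hw
  simp only [Set.mem_insert_iff, Set.mem_singleton_iff, not_or] at hw
  have : Nontrivial ((({x, y} : Set V) \ {v})ᶜ : Set V) :=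
    ⟨⟨v, by simp⟩, ⟨w, by simp [hw]⟩, fun h => hw.1 (congrArg Subtype.val h).symm⟩
  obtain ⟨⟨u, hu⟩, huv⟩ := hcon.preconnected.exists_adj_of_nontrivial ⟨v, by simp⟩
  replace huv : G.Adj v u := huv
  refine hu ⟨?_, huv.ne'⟩
  by_cases hux : u = x
  · exact Or.inl hux
  · exact Or.inr (h u huv hux)

/-- A walk can be projected when edges may collapse to points, as they do under the projection of a
product to a factor. -/
theorem Reachable.of_forall_adj_or_eq {f : V → W} {u v : V} (h : G.Reachable u v)
    (hf : ∀ a b, G.Adj a b → H.Adj (f a) (f b) ∨ f a = f b) : H.Reachable (f u) (f v) := by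
  obtain ⟨q⟩ := h
  induction q with
  | nil => rfl
  | cons h _ ih =>
    rcases hf _ _ h with h | h
    · exact h.reachable.trans ih
    · rwa [h]

theorem Connected.exists_adj_adj (hG : G.Connected) (hV : 2 < Nat.card V) :
    ∃ b x y, G.Adj b x ∧ G.Adj b y ∧ x ≠ y := by
  have : Finite V := Nat.finite_of_card_ne_zero (by omega)
  have : Nontrivial V := Finite.one_lt_card_iff_nontrivial.1 (by omega)
  obtain ⟨u⟩ := hG.nonempty
  obtain ⟨v, huv⟩ := hG.preconnected.exists_adj_of_nontrivial u
  obtain ⟨w, hw⟩ : ∃ w, w ∉ ({u, v} : Set V) := by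
    by_contra! h
    have h1 := Set.ncard_univ V
    rw [← Set.eq_univ_of_forall h] at h1
    have h2 := Set.ncard_insert_le u {v}
    rw [Set.ncard_singleton] at h2
    omega
  obtain ⟨q⟩ := hG.preconnected u w
  obtain ⟨⟨⟨a, b⟩, hab⟩, -, ha, hb⟩ := q.exists_boundary_dart {u, v} (by simp) hw
  simp only [Set.mem_insert_iff, Set.mem_singleton_iff, not_or] at ha hb
  rcases ha with rfl | rfl
  · exact ⟨a, v, b, huv, hab, fun h => hb.2 h.symm⟩
  · exact ⟨a, u, b, huv.symm, hab, fun h => hb.1 h.symm⟩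

end

section

variable {α β α' β' : Type*} {A : SimpleGraph α} {B : SimpleGraph β} {A' : SimpleGraph α'}
  {B' : SimpleGraph β'}

/-- The isomorphism between products given by isomorphisms between the factors. -/
def boxProdIso (e : A ≃g A') (f : B ≃g B') : (A □ B) ≃g (A' □ B') where
  toEquiv := e.toEquiv.prodCongr f.toEquiv
  map_rel_iff' := by
    rintro ⟨a, b⟩ ⟨a', b'⟩
    simp [boxProd_adj, e.map_adj_iff, f.map_adj_iff]

/-- The product of a connected graph with an edge and a `2`-connected graph is `3`-connected. -/
theorem IsKConnected.boxProd [Finite α] [Finite β] [Nontrivial α] (hA : A.Connected)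
    (hB : B.IsKConnected 2) : (A □ B).IsKConnected 3 := by
  have hcard : 2 < Nat.card β := by
    have := hB.1
    rw [ENat.card_eq_coe_natCard] at this
    exact_mod_cast this
  have hcardA : 1 < Nat.card α := Finite.one_lt_card_iff_nontrivial.2 ‹_›
  refine ⟨?_, fun S hS => ?_⟩
  · rw [ENat.card_eq_coe_natCard, Nat.card_prod]
    have : 3 < Nat.card α * Nat.card β := by nlinarith
    exact_mod_cast this
  have hfin : S.Finite := S.toFinite
  have hS' : S.ncard < 3 := by
    rw [← hfin.cast_ncard_eq] at hS
    exact_mod_cast hS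
  -- a column that avoids `S`
  obtain ⟨b, hb⟩ : ∃ b, ∀ a, (a, b) ∉ S := by
    by_contra! h
    have h1 : (Set.univ : Set β) ⊆ Prod.snd '' S := fun b _ => by
      obtain ⟨a, ha⟩ := h b
      exact ⟨_, ha, rfl⟩
    have h2 := Set.ncard_le_ncard h1 (hfin.image _)
    have h3 := Set.ncard_image_le (f := Prod.snd) hfin
    rw [Set.ncard_univ] at h2
    omega
  obtain ⟨a₀⟩ := hA.nonempty
  have hcol : ∀ a, ((A □ B).induce Sᶜ).Reachable ⟨(a, b), hb a⟩ ⟨(a₀, b), hb a₀⟩ := by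
    intro a
    let f : A →g (A □ B).induce Sᶜ := ⟨fun a => ⟨(a, b), hb a⟩, fun h => boxProd_adj_left.2 h⟩
    exact (hA.preconnected a a₀).map f
  have hrow : ∀ a, {c | (a, c) ∈ S}.encard < (2 : ℕ) → ∀ c (hc : (a, c) ∉ S),
      ((A □ B).induce Sᶜ).Reachable ⟨(a, c), hc⟩ ⟨(a, b), hb a⟩ := by
    intro a ha c hc
    let f : B.induce {c | (a, c) ∈ S}ᶜ →g (A □ B).induce Sᶜ :=
      ⟨fun c => ⟨(a, c), c.2⟩, fun h => boxProd_adj_right.2 h⟩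
    exact ((hB.2 _ ha).preconnected ⟨c, hc⟩ ⟨b, hb a⟩).map f
  -- At most two vertices are deleted. A row that loses two of them leaves all other rows intact;
  -- every other row stays connected, as `B` is 2-connected, and reaches the free column.
  have hrows : ∀ a a', a ≠ a' → ¬ {c | (a, c) ∈ S}.encard < (2 : ℕ) → ∀ c, (a', c) ∉ S := by
    intro a a' haa ha c hc
    apply ha
    have h1 : (Prod.mk a '' {c | (a, c) ∈ S}) ⊆ S \ {(a', c)} := by
      rintro _ ⟨d, hd, rfl⟩
      exact ⟨hd, fun h => haa (congrArg Prod.fst h)⟩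
    have h2 := Set.ncard_le_ncard h1 (hfin.subset Set.sdiff_subset)
    rw [Set.ncard_image_of_injective _ (Prod.mk_right_injective a),
      Set.ncard_sdiff_singleton_of_mem hc] at h2
    rw [← (Set.toFinite {c | (a, c) ∈ S}).cast_ncard_eq]
    exact_mod_cast (by omega)
  rw [connected_iff_exists_forall_reachable]
  refine ⟨⟨(a₀, b), hb a₀⟩, ?_⟩
  rintro ⟨⟨a, c⟩, hc⟩
  refine Reachable.symm ?_
  by_cases ha : {c | (a, c) ∈ S}.encard < (2 : ℕ)
  · exact (hrow a ha c hc).trans (hcol a)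
  · obtain ⟨a', haa'⟩ := hA.preconnected.exists_adj_of_nontrivial a
    have hr := hrows a a' haa'.ne ha
    have hempty : {c | (a', c) ∈ S} = ∅ := Set.eq_empty_of_forall_notMem hr
    have h1 : ((A □ B).induce Sᶜ).Adj ⟨(a, c), hc⟩ ⟨(a', c), hr c⟩ := boxProd_adj_left.2 haa'
    exact h1.reachable.trans ((hrow a' (by rw [hempty]; simp) c (hr c)).trans (hcol a'))

/-- If the product of an edge and `B` is `3`-connected, then `B` is `2`-connected. -/
theorem IsKConnected.of_top_boxProd [Finite β]
    (h : ((⊤ : SimpleGraph (Fin 2)) □ B).IsKConnected 3) : B.IsKConnected 2 := by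
  constructor
  · by_contra hcard
    rw [ENat.card_eq_coe_natCard, not_lt] at hcard
    replace hcard : Nat.card β ≤ 2 := by exact_mod_cast hcard
    obtain ⟨⟨-, b⟩⟩ := (h.connected (by omega)).nonempty
    obtain ⟨b', hb'⟩ : ∃ b', ∀ c, c ≠ b → c = b' := by
      by_contra! hc
      obtain ⟨c, hcb, -⟩ := hc b
      obtain ⟨d, hdb, hdc⟩ := hc c
      have h1 := Set.ncard_le_card ({b, c, d} : Set β)
      rw [Set.ncard_eq_three.2 ⟨b, c, d, hcb.symm, hdb.symm, hdc.symm, rfl⟩] at h1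
      omega
    -- With at most two vertices in `B`, the vertex `(0, b)` can only be adjacent to `(1, b)` and
    -- `(0, b')`.
    obtain ⟨⟨i, c⟩, hadj, h1, h2⟩ := h.exists_adj_ne (0, b) (1, b) (0, b')
    rw [boxProd_adj] at hadj
    obtain ⟨hi, hbc⟩ | ⟨hbc, hi⟩ := hadj
    · replace hi : (0 : Fin 2) ≠ i := hi
      replace hbc : b = c := hbc
      exact h1 (Prod.ext (show i = 1 by omega) hbc.symm)
    · exact h2 (Prod.ext hi.symm (hb' c hbc.ne'))
  · intro S hS
    -- Both copies of `S` are deleted. As `S` has at most one element, these are at most two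
    -- vertices, and what remains projects onto `Sᶜ`.
    have h1 : ((Set.univ : Set (Fin 2)) ×ˢ S).encard < (3 : ℕ) := by
      have hS' : S.ncard < 2 := by
        rw [← S.toFinite.cast_ncard_eq] at hS
        exact_mod_cast hS
      rw [← (Set.toFinite _).cast_ncard_eq, Set.ncard_prod]
      have : (Set.univ : Set (Fin 2)).ncard = 2 := by simp
      rw [this]
      exact_mod_cast (by omega)
    have hcon := h.2 _ h1
    obtain ⟨⟨⟨i, b⟩, hb⟩⟩ := hcon.nonempty
    have hb' : b ∉ S := fun hb' => hb ⟨trivial, hb'⟩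
    rw [connected_iff_exists_forall_reachable]
    refine ⟨⟨b, hb'⟩, fun ⟨c, hc⟩ => ?_⟩
    have hc' : (i, c) ∉ (Set.univ : Set (Fin 2)) ×ˢ S := fun h => hc h.2
    refine (hcon.preconnected ⟨(i, b), hb⟩ ⟨(i, c), hc'⟩).of_forall_adj_or_eq
      (f := fun x => (⟨x.1.2, fun h => x.2 ⟨trivial, h⟩⟩ : (Sᶜ : Set β))) ?_
    rintro ⟨⟨j, d⟩, hd⟩ ⟨⟨j', d'⟩, hd'⟩ hadj
    replace hadj : ((⊤ : SimpleGraph (Fin 2)) □ B).Adj (j, d) (j', d') := hadj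
    rw [boxProd_adj] at hadj
    obtain ⟨-, h⟩ | ⟨h, -⟩ := hadj
    · exact Or.inr (Subtype.ext h)
    · exact Or.inl h

/-- The product of two paths has vertices of degree two. -/
theorem not_isKConnected_pathGraph_boxProd {m n : ℕ} (hm : 2 ≤ m) (hn : 2 ≤ n) :
    ¬ (pathGraph m □ pathGraph n).IsKConnected 3 := by
  intro h
  have key : ∀ {k : ℕ} (hk : 2 ≤ k) (i : Fin k), (pathGraph k).Adj ⟨0, by omega⟩ i →
      i = ⟨1, by omega⟩ := by
    intro k hk i hi
    rw [pathGraph_adj] at hi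
    exact Fin.ext (by simp at hi ⊢; omega)
  obtain ⟨⟨i, j⟩, hadj, h1, h2⟩ := h.exists_adj_ne (⟨0, by omega⟩, ⟨0, by omega⟩)
    (⟨1, by omega⟩, ⟨0, by omega⟩) (⟨0, by omega⟩, ⟨1, by omega⟩)
  rw [boxProd_adj] at hadj
  obtain ⟨hi, hj⟩ | ⟨hj, hi⟩ := hadj
  · exact h1 (Prod.ext (key hm i hi) hj.symm)
  · exact h2 (Prod.ext hi.symm (key hn j hj))

theorem cycleGraph_adj_mod {k : ℕ} (hk : 3 ≤ k) (x : ℕ) :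
    (cycleGraph k).Adj ⟨x % k, Nat.mod_lt _ (by omega)⟩ ⟨(x + 1) % k, Nat.mod_lt _ (by omega)⟩ := by
  have key : ∀ y (hy : y < k),
      (cycleGraph k).Adj ⟨y, hy⟩ ⟨(y + 1) % k, Nat.mod_lt _ (by omega)⟩ := by
    intro y hy
    rcases Nat.lt_or_ge (y + 1) k with h | h
    · apply pathGraph_le_cycleGraph
      rw [pathGraph_adj]
      simp [Nat.mod_eq_of_lt h]
    · have h' : y + 1 = k := by omega
      rw [cycleGraph_adj']
      right
      simp only [Fin.sub_def, h', Nat.mod_self]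
      rw [Nat.mod_eq_of_lt (by omega)]
      omega
  simpa only [Nat.mod_add_mod] using key (x % k) (Nat.mod_lt _ (by omega))

theorem isKConnected_cycleGraph {k : ℕ} (hk : 3 ≤ k) : (cycleGraph k).IsKConnected 2 := by
  refine ⟨by rw [ENat.card_eq_coe_natCard, Nat.card_fin]; exact_mod_cast hk, fun S hS => ?_⟩
  have hS' : S.encard ≤ 1 := by
    rw [← S.toFinite.cast_ncard_eq] at hS ⊢
    have : S.ncard < 2 := by exact_mod_cast hS
    exact_mod_cast (by omega : S.ncard ≤ 1)
  rcases Set.encard_le_one_iff_eq.1 hS' with rfl | ⟨v, rfl⟩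
  · rw [Set.compl_empty]
    refine (induceUnivIso _).connected_iff.2 ?_
    obtain ⟨k, rfl⟩ : ∃ k', k = k' + 1 := ⟨k - 1, by omega⟩
    exact cycleGraph_connected
  -- Without `v`, the cycle is the path that starts at the successor of `v` and goes once around.
  · let f : ℕ → Fin k := fun i => ⟨(v.val + 1 + i) % k, Nat.mod_lt _ (by omega)⟩
    have hf : f '' Set.Ico 0 (k - 1) = {v}ᶜ := by
      have hv := v.2
      ext w
      simp only [Set.mem_image, Set.mem_Ico, Set.mem_compl_iff, Set.mem_singleton_iff,
        Fin.ext_iff, f]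
      have hw := w.2
      constructor
      · rintro ⟨i, hi, h⟩ hwv
        rcases Nat.lt_or_ge (v.val + 1 + i) k with h' | h'
        · rw [Nat.mod_eq_of_lt h'] at h
          omega
        · rw [Nat.mod_eq_sub_mod h', Nat.mod_eq_of_lt (by omega)] at h
          omega
      · intro h
        rcases Nat.lt_or_ge v.val w.val with h' | h'
        · exact ⟨w.val - v.val - 1, by omega, by rw [Nat.mod_eq_of_lt] <;> omega⟩
        · refine ⟨w.val + k - v.val - 1, by omega, ?_⟩
          rw [show v.val + 1 + (w.val + k - v.val - 1) = w.val + k by omega, Nat.add_mod_right,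
            Nat.mod_eq_of_lt hw]
    rw [← hf]
    exact connected_induce_image_Ico (by omega) fun i _ _ => cycleGraph_adj_mod hk (v.val + 1 + i)

end

end SimpleGraph

/-! ### Graphs of maximum degree two; assembling the proof -/

namespace SimpleGraph

/-- A finite connected graph all of whose vertices have at most two neighbours is a path or a
cycle. -/
theorem Connected.exists_iso_of_forall_adj {V : Type*} [Finite V] {G : SimpleGraph V}
    (hG : G.Connected)
    (h₃ : ∀ v x y z, G.Adj v x → G.Adj v y → G.Adj v z → x ≠ y → x ≠ z → y ≠ z → False) :
    ∃ n, Nonempty (G ≃g pathGraph n) ∨ (3 ≤ n ∧ Nonempty (G ≃g cycleGraph n)) := by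
  classical
  have hbound : ∀ l : List V, l.Nodup → l.length ≤ Nat.card V := fun l hl => by
    have : Fintype V := Fintype.ofFinite V
    rw [Nat.card_eq_fintype_card]
    exact hl.length_le_card
  obtain ⟨v₀⟩ := hG.nonempty
  obtain ⟨l, ⟨hn, hc, hl₀⟩, hmax⟩ : ∃ l : List V, (l.Nodup ∧ l.IsChain G.Adj ∧ l ≠ []) ∧
      ∀ l' : List V, l'.Nodup → l'.IsChain G.Adj → l'.length ≤ l.length := by
    let S : Set ℕ := {k | ∃ l : List V, (l.Nodup ∧ l.IsChain G.Adj) ∧ l.length = k}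
    have hS : BddAbove S := ⟨Nat.card V, by rintro _ ⟨l, ⟨hl, -⟩, rfl⟩; exact hbound l hl⟩
    have h1 : 1 ∈ S := ⟨[v₀], ⟨by simp, by simp⟩, rfl⟩
    obtain ⟨l, ⟨hn, hc⟩, hlen⟩ := Nat.sSup_mem ⟨1, h1⟩ hS
    refine ⟨l, ⟨hn, hc, ?_⟩, fun l' h h' => hlen ▸ le_csSup hS ⟨l', ⟨h, h'⟩, rfl⟩⟩
    rintro rfl
    have := le_csSup hS h1
    simp at hlen
    omega
  have hchain : ∀ i (h : i + 1 < l.length), G.Adj l[i] l[i + 1] := fun i h => hc.getElem i h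
  have hne : ∀ i j (hi : i < l.length) (hj : j < l.length), i ≠ j → l[i] ≠ l[j] :=
    fun i j hi hj hij h => hij ((hn.getElem_inj_iff).1 h)
  -- A neighbour outside a longest path would prolong it at an end, or be a third neighbour of an
  -- inner vertex. By connectedness the path then contains every vertex.
  have hclosed : ∀ a ∈ l, ∀ w, G.Adj a w → w ∈ l := by
    intro a ha w haw
    by_contra hw
    obtain ⟨i, hi, rfl⟩ := List.getElem_of_mem ha
    have hwne : ∀ j (hj : j < l.length), l[j] ≠ w := fun j hj h => hw (h ▸ List.getElem_mem hj)
    rcases Nat.eq_zero_or_pos i with rfl | h0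
    · have := hmax (w :: l) (List.nodup_cons.2 ⟨hw, hn⟩) (hc.cons fun y hy => by
        rw [List.head?_eq_getElem?, List.getElem?_eq_getElem hi] at hy
        obtain rfl := Option.some_injective _ hy
        exact haw.symm)
      simp at this
    · rcases Nat.lt_or_ge (i + 1) l.length with h1 | h1
      · obtain ⟨i, rfl⟩ : ∃ i', i = i' + 1 := ⟨i - 1, by omega⟩
        exact h₃ _ _ _ _ (hchain i hi).symm (hchain (i + 1) h1) haw (hne _ _ _ _ (by omega))
          (hwne _ _) (hwne _ _)
      · have := hmax (l ++ [w]) (List.nodup_append.2 ⟨hn, by simp, by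
          rintro a ha b hb rfl
          rw [List.mem_singleton] at hb
          exact hw (hb ▸ ha)⟩) (hc.append (List.IsChain.singleton w) ?_)
        · simp at this
        · intro y hy z hz
          rw [List.getLast?_eq_getElem?, show l.length - 1 = i by omega,
            List.getElem?_eq_getElem hi] at hy
          obtain rfl := Option.some_injective _ hy
          obtain rfl := Option.some_injective _ hz
          exact haw
  have hmem : ∀ v, v ∈ l := by
    intro v
    by_contra hv
    obtain ⟨q⟩ := hG.preconnected (l.head hl₀) v
    obtain ⟨d, -, hd, hd'⟩ := q.exists_boundary_dart {a | a ∈ l} (List.head_mem hl₀) hv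
    exact hd' (hclosed _ hd _ d.adj)
  let E := hn.getEquivOfForallMemList l hmem
  have hE : ∀ i, E i = l[i] := fun i => rfl
  -- Any edge other than a path edge or the one joining both ends has an inner vertex of the path as
  -- an end and gives it a third neighbour.
  have key : ∀ i j : Fin l.length, i < j → G.Adj (E i) (E j) →
      i.val + 1 = j.val ∨ (i.val = 0 ∧ j.val + 1 = l.length) := by
    rintro ⟨i, hi⟩ ⟨j, hj⟩ hij h
    replace hij : i < j := hij
    replace h : G.Adj l[i] l[j] := h
    by_contra! hcon
    replace hcon : i + 1 ≠ j ∧ (i = 0 → j + 1 ≠ l.length) := hcon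
    rcases Nat.eq_zero_or_pos i with h0 | h0
    · obtain ⟨j, rfl⟩ : ∃ j', j = j' + 1 := ⟨j - 1, by omega⟩
      exact h₃ _ _ _ _ (hchain j hj).symm (hchain (j + 1) (by omega)) h.symm
        (hne _ _ _ _ (by omega)) (hne _ _ _ _ (by omega)) (hne _ _ _ _ (by omega))
    · obtain ⟨i, rfl⟩ : ∃ i', i = i' + 1 := ⟨i - 1, by omega⟩
      exact h₃ _ _ _ _ (hchain i hi).symm (hchain (i + 1) (by omega)) h
        (hne _ _ _ _ (by omega)) (hne _ _ _ _ (by omega)) (hne _ _ _ _ (by omega))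
  have hpath : ∀ i j : Fin l.length, (pathGraph l.length).Adj i j → G.Adj (E i) (E j) := by
    intro i j h
    change G.Adj l[i.val] l[j.val]
    rcases pathGraph_adj.1 h with h | h
    · have := hchain i.val (by omega)
      simpa only [h] using this
    · have := hchain j.val (by omega)
      simpa only [h] using this.symm
  -- The bound excludes a path on two vertices, whose ends are adjacent without closing a cycle.
  by_cases hcyc : ∃ (_ : 3 ≤ l.length),
      G.Adj (E ⟨0, by omega⟩) (E ⟨l.length - 1, by omega⟩)
  · obtain ⟨h3, hcyc⟩ := hcyc
    refine ⟨l.length, Or.inr ⟨h3, ⟨RelIso.symm ⟨E, fun {i j} => ⟨fun h => ?_, fun h => ?_⟩⟩⟩⟩⟩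
    · have hlt : ∀ i j : Fin l.length, i < j → G.Adj (E i) (E j) →
          (cycleGraph l.length).Adj i j := by
        intro i j hij h
        rcases key i j hij h with h | ⟨h, h'⟩
        · exact pathGraph_le_cycleGraph (pathGraph_adj.2 (Or.inl h))
        · have := cycleGraph_adj_mod h3 (l.length - 1)
          have e1 : (⟨(l.length - 1) % l.length, Nat.mod_lt _ (by omega)⟩ : Fin l.length) = j :=
            Fin.ext (by
              change (l.length - 1) % l.length = j.val
              rw [Nat.mod_eq_of_lt] <;> omega)
          have e2 : (⟨(l.length - 1 + 1) % l.length, Nat.mod_lt _ (by omega)⟩ : Fin l.length) = i :=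
            Fin.ext (by
              change (l.length - 1 + 1) % l.length = i.val
              rw [Nat.sub_add_cancel (by omega), Nat.mod_self, h])
          rw [e1, e2] at this
          exact this.symm
      rcases lt_or_gt_of_ne (fun hij => h.ne (congrArg E hij) : i ≠ j) with hij | hij
      · exact hlt i j hij h
      · exact (hlt j i hij h.symm).symm
    · have hstep : ∀ i j : Fin l.length, j.val = (i.val + 1) % l.length → G.Adj (E i) (E j) := by
        intro i j hij
        rcases Nat.lt_or_ge (i.val + 1) l.length with h | h
        · rw [Nat.mod_eq_of_lt h] at hij
          exact hpath i j (pathGraph_adj.2 (Or.inl hij.symm))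
        · have h' : i.val + 1 = l.length := by omega
          rw [h', Nat.mod_self] at hij
          have hlast : l.length - 1 < l.length := by omega
          have e1 : i = ⟨l.length - 1, hlast⟩ := Fin.ext (by
            change i.val = l.length - 1
            omega)
          have e2 : j = ⟨0, i.pos⟩ := Fin.ext hij
          rw [e1, e2]
          exact hcyc.symm
      rcases val_eq_of_cycleGraph_adj h with h | h
      · exact hstep i j h
      · exact (hstep j i h).symm
  · refine ⟨l.length, Or.inl ⟨RelIso.symm ⟨E, fun {i j} => ⟨fun h => ?_, fun h => hpath i j h⟩⟩⟩⟩
    have hlt : ∀ i j : Fin l.length, i < j → G.Adj (E i) (E j) → (pathGraph l.length).Adj i j := by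
      intro i j hij h
      rw [pathGraph_adj]
      rcases key i j hij h with h' | ⟨h', h''⟩
      · exact Or.inl h'
      · left
        by_contra hcon
        have h3 : 3 ≤ l.length := by
          have : i.val < j.val := hij
          omega
        refine hcyc ⟨h3, ?_⟩
        have e1 : (⟨0, by omega⟩ : Fin l.length) = i := Fin.ext h'.symm
        have e2 : (⟨l.length - 1, by omega⟩ : Fin l.length) = j := Fin.ext (by
          change l.length - 1 = j.val
          omega)
        rw [e1, e2]
        exact h
    rcases lt_or_gt_of_ne (fun hij => h.ne (congrArg E hij) : i ≠ j) with hij | hij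
    · exact hlt i j hij h
    · exact (hlt j i hij h.symm).symm

variable {V α β : Type*} {A : SimpleGraph α} {B : SimpleGraph β}

theorem IsThreePolytopal.of_iso {W : Type*} {G : SimpleGraph V} {H : SimpleGraph W} (e : G ≃g H)
    (hG : G.IsThreePolytopal) : H.IsThreePolytopal := by
  obtain ⟨hfin, hp, hc⟩ := hG
  exact ⟨Finite.of_equiv _ e.toEquiv, hp.comap e.symm.toHom e.symm.injective, hc.of_iso e⟩

theorem isThreePolytopal_boxProd_of_isOuterplanar [Finite α] [Finite β]
    (eA : A ≃g (⊤ : SimpleGraph (Fin 2))) (hB : B.IsOuterplanar) (hB₂ : B.IsKConnected 2) :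
    (A □ B).IsThreePolytopal := by
  refine IsThreePolytopal.of_iso (boxProdIso eA Iso.refl).symm ?_
  obtain ⟨n, e, he⟩ := hB.exists_equiv hB₂
  exact ⟨inferInstance, isPlanar_top_boxProd e he, hB₂.boxProd connected_top⟩

theorem isThreePolytopal_boxProd_of_path_of_cycle {n k : ℕ} (hn : 2 ≤ n) (hk : 3 ≤ k)
    (eA : A ≃g pathGraph n) (eB : B ≃g cycleGraph k) : (A □ B).IsThreePolytopal := by
  refine IsThreePolytopal.of_iso (boxProdIso eA eB).symm ?_
  have : Nontrivial (Fin n) := Fin.nontrivial_iff_two_le.2 hn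
  have hcon : (pathGraph n).Connected := by
    obtain ⟨n, rfl⟩ : ∃ n', n = n' + 1 := ⟨n - 1, by omega⟩
    exact pathGraph_connected n
  exact ⟨inferInstance, isPlanar_pathGraph_boxProd_cycleGraph n hk,
    (isKConnected_cycleGraph hk).boxProd hcon⟩

theorem Connected.nonempty_iso_top (hA : A.Connected) (hcard : Nat.card α = 2) :
    Nonempty (A ≃g (⊤ : SimpleGraph (Fin 2))) := by
  have : Finite α := Nat.finite_of_card_ne_zero (by omega)
  have : Nontrivial α := Finite.one_lt_card_iff_nontrivial.1 (by omega)
  let e := Finite.equivFinOfCardEq hcard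
  have h2 : ∀ a b c : α, a ≠ b → a ≠ c → b = c := by
    intro a b c hab hac
    have h1 := e.injective.ne hab
    have h2 := e.injective.ne hac
    exact e.injective (by omega)
  refine ⟨⟨e, fun {a b} => ?_⟩⟩
  rw [top_adj, e.injective.ne_iff]
  refine ⟨fun hab => ?_, fun h => h.ne⟩
  obtain ⟨c, hc⟩ := hA.preconnected.exists_adj_of_nontrivial a
  exact h2 a c b hc.ne hab ▸ hc

theorem IsThreePolytopal.of_boxProd_of_iso_top [Finite β] (h : (A □ B).IsThreePolytopal)
    (eA : A ≃g (⊤ : SimpleGraph (Fin 2))) : B.IsOuterplanar ∧ B.IsKConnected 2 := by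
  obtain ⟨-, hp, hc⟩ := h.of_iso (boxProdIso eA Iso.refl)
  exact ⟨hp.isOuterplanar_of_boxProd (a₀ := 0) (a₁ := 1) (by simp)
    (hc.connected (by omega)).ofBoxProdRight, hc.of_top_boxProd⟩

/-- A path on three vertices in either factor forbids a claw in the other, so each factor is a path
or a cycle. Two paths violate 3-connectedness and two cycles violate planarity. -/
theorem IsThreePolytopal.exists_iso_of_boxProd [Finite α] [Finite β]
    (h : (A □ B).IsThreePolytopal) (hα : 2 < Nat.card α) (hβ : 2 < Nat.card β) :
    ∃ n k : ℕ, 2 ≤ n ∧ 3 ≤ k ∧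
      ((Nonempty (A ≃g pathGraph n) ∧ Nonempty (B ≃g cycleGraph k)) ∨
       (Nonempty (B ≃g pathGraph n) ∧ Nonempty (A ≃g cycleGraph k))) := by
  obtain ⟨-, hp, hc⟩ := h
  have hcon := hc.connected (by omega)
  have hA := hcon.ofBoxProdLeft
  have hB := hcon.ofBoxProdRight
  have hp' : (B □ A).IsPlanar := hp.comap (boxProdComm B A).toHom (boxProdComm B A).injective
  obtain ⟨bA, xA, yA, hxA, hyA, hxyA⟩ := hA.exists_adj_adj hα
  obtain ⟨bB, xB, yB, hxB, hyB, hxyB⟩ := hB.exists_adj_adj hβ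
  obtain ⟨m, eA⟩ := hA.exists_iso_of_forall_adj fun v x y z h₀ h₁ h₂ h₀₁ h₀₂ h₁₂ =>
    hp.elim fun D => D.nonempty_weakDrawing.elim
      (isEmpty_weakDrawing_claw_boxProd h₀ h₁ h₂ h₀₁ h₀₂ h₁₂ hxB hyB hxyB).false
  obtain ⟨n, eB⟩ := hB.exists_iso_of_forall_adj fun v x y z h₀ h₁ h₂ h₀₁ h₀₂ h₁₂ =>
    hp'.elim fun D => D.nonempty_weakDrawing.elim
      (isEmpty_weakDrawing_claw_boxProd h₀ h₁ h₂ h₀₁ h₀₂ h₁₂ hxA hyA hxyA).false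
  rcases eA with eA | ⟨hm, ⟨eA⟩⟩
  · have hm : 2 ≤ m := by
      rw [Nat.card_congr eA.some.toEquiv, Nat.card_fin] at hα
      omega
    rcases eB with eB | ⟨hn, eB⟩
    · have hn : 2 ≤ n := by
        rw [Nat.card_congr eB.some.toEquiv, Nat.card_fin] at hβ
        omega
      exact (not_isKConnected_pathGraph_boxProd hm hn
        (hc.of_iso (boxProdIso eA.some eB.some))).elim
    · exact ⟨m, n, hm, hn, Or.inl ⟨eA, eB⟩⟩
  · rcases eB with eB | ⟨hn, ⟨eB⟩⟩
    · have hn : 2 ≤ n := by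
        rw [Nat.card_congr eB.some.toEquiv, Nat.card_fin] at hβ
        omega
      exact ⟨n, m, hn, hm, Or.inr ⟨eB, ⟨eA⟩⟩⟩
    · exfalso
      let e := boxProdIso eA eB
      obtain ⟨D⟩ := hp.comap e.symm.toHom e.symm.injective
      obtain ⟨D'⟩ := D.nonempty_weakDrawing
      obtain ⟨m, rfl⟩ : ∃ m', m = m' + 3 := ⟨m - 3, by omega⟩
      obtain ⟨n, rfl⟩ : ∃ n', n = n' + 3 := ⟨n - 3, by omega⟩
      exact (((isMinorModel_cycleGraph m).boxProd
        (isMinorModel_cycleGraph n)).nonempty_weakDrawing D').elim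
        isEmpty_weakDrawing_triangle_boxProd.false

end SimpleGraph

theorem mainTheorem7 {V α β : Type*} [Finite α] [Finite β] [Nontrivial α] [Nontrivial β]
    (A : SimpleGraph α) (B : SimpleGraph β) (P : SimpleGraph V)
    (hP : Nonempty (P ≃g A □ B)) :
    P.IsThreePolytopal ↔
      (Nonempty (A ≃g (⊤ : SimpleGraph (Fin 2))) ∧ B.IsOuterplanar ∧ B.IsKConnected 2) ∨
      (Nonempty (B ≃g (⊤ : SimpleGraph (Fin 2))) ∧ A.IsOuterplanar ∧ A.IsKConnected 2) ∨
      (∃ n k : ℕ, 2 ≤ n ∧ 3 ≤ k ∧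
        ((Nonempty (A ≃g SimpleGraph.pathGraph n) ∧ Nonempty (B ≃g SimpleGraph.cycleGraph k)) ∨
         (Nonempty (B ≃g SimpleGraph.pathGraph n) ∧ Nonempty (A ≃g SimpleGraph.cycleGraph k)))) := by
  open SimpleGraph in
  obtain ⟨e⟩ := hP
  have hα : 1 < Nat.card α := Finite.one_lt_card_iff_nontrivial.2 ‹_›
  have hβ : 1 < Nat.card β := Finite.one_lt_card_iff_nontrivial.2 ‹_›
  constructor
  · intro h
    have hAB := h.of_iso e
    have hBA := hAB.of_iso (boxProdComm A B)
    have hcon := hAB.2.2.connected (by omega)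
    by_cases h₁ : Nat.card α = 2
    · obtain ⟨eA⟩ := hcon.ofBoxProdLeft.nonempty_iso_top h₁
      exact Or.inl ⟨⟨eA⟩, hAB.of_boxProd_of_iso_top eA⟩
    · by_cases h₂ : Nat.card β = 2
      · obtain ⟨eB⟩ := hcon.ofBoxProdRight.nonempty_iso_top h₂
        exact Or.inr (Or.inl ⟨⟨eB⟩, hBA.of_boxProd_of_iso_top eB⟩)
      · exact Or.inr (Or.inr (hAB.exists_iso_of_boxProd (by omega) (by omega)))
  · rintro (⟨⟨eA⟩, hB, hB₂⟩ | ⟨⟨eB⟩, hA, hA₂⟩ | ⟨n, k, hn, hk, ⟨⟨eA⟩, ⟨eB⟩⟩ | ⟨⟨eB⟩, ⟨eA⟩⟩⟩)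
    · exact (isThreePolytopal_boxProd_of_isOuterplanar eA hB hB₂).of_iso e.symm
    · exact ((isThreePolytopal_boxProd_of_isOuterplanar eB hA hA₂).of_iso
        (boxProdComm B A)).of_iso e.symm
    · exact (isThreePolytopal_boxProd_of_path_of_cycle hn hk eA eB).of_iso e.symm
    · exact ((isThreePolytopal_boxProd_of_path_of_cycle hn hk eB eA).of_iso
        (boxProdComm B A)).of_iso e.symm
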